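/- Let $L$ be a finite boolean lattice, regarded as a category, let $1=\max(L)$, and let $\mathcal F\colon L\to\mathcal{A}b$ be a covariant functor to abelian groups. *Relative homology.* For a poset $X$ and a functor $\mathcal G\colon X\to\mathcal{A}b$, let $C_*(X;\mathcal G)$ be the chain complex with $C_n(X;\mathcal G)=\bigoplus_\sigma \mathcal G(\min\sigma)$, the sum being over all $n$-chains $\sigma=\{\sigma_0<\cdots<\sigma_n\}$ of $X$ (with $C_n=0$ for $n<0$). Its differential sends $\lambda$ in the summand of $\sigma$ to $\sum_{i=0}^n(-1)^i\,\mathcal G\big(\min\sigma\le\min(\sigma-\{\sigma_i\})\big)(\lambda)$, with the $i$-th term in the summand of $\sigma-\{\sigma_i\}$, for $n\ge 1$ (and is $0$ for $n=0$). For $A\subseteq X$, let $H_n(X,A;\mathcal G)$ be the $n$-th homology group of the quotient complex $C_*(X;\mathcal G)/C_*(A;\mathcal G|_A)$. *Khovanov's cube complex.* Let $\operatorname{rk}(x)$ be the greatest length $l$ of a chain $x_0<\cdots<x_l=x$ in $L$, and let $r=\operatorname{rk}(1)$, which is the number of atoms of $L$. Choose a total ordering $a_1,\dots,a_r$ of the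 atoms of $L$; for $x\in L$ let $x_j=1$ if $a_j\le x$ and $x_j=0$ otherwise. If $y$ covers $x$ (written $x\prec y$), there is a unique index $m$ with $x_m=0$ and $y_m=1$; put $\varepsilon(x\prec y)=\prod_{j=1}^{m}(-1)^{x_j}$. Let $\mathcal K_*(L,\mathcal F)$ be the chain complex with $\mathcal K_n(L,\mathcal F)=\bigoplus_{\operatorname{rk}(x)=r-n}\mathcal F(x)$ for $n\in\mathbb Z$, whose differential $\mathcal K_n\to\mathcal K_{n-1}$ sends $\lambda\in\mathcal F(x)$ to $\sum_{y\succ x}\varepsilon(x\prec y)\,\mathcal F(x\le y)(\lambda)$, the sum being over the elements $y$ that cover $x$. Then, for every choice of the total ordering of the atoms and for every $n\in\mathbb Z$, $$H_n(\mathcal K_*(L,\mathcal F))\cong H_n(L,L-\{1\};\mathcal F).$$ -/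

import Mathlib

open CategoryTheory

universe u v

noncomputable section

namespace PosetHomology

/-! ### Homology of posets with functor coefficients -/

section Chains

variable {X : Type u} [PartialOrder X]

/-- `s` is an `n`-chain of the poset `X`: a non-empty finite totally ordered subset with `n + 1`
elements. (For a negative integer `n` there are none.) -/
structure IsNChain (n : ℤ) (s : Finset X) : Prop where
  nonempty : s.Nonempty
  isChain : IsChain (· ≤ ·) (s : Set X)
  card_eq : (s.card : ℤ) = n + 1

variable (X) in
/-- The set `Ch_n(X)` of `n`-chains of `X`. -/
abbrev NChain (n : ℤ) : Type u := {s : Finset X // IsNChain n s}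

theorem NChain.exists_isLeast {n : ℤ} (s : NChain X n) : ∃ x, IsLeast (s.1 : Set X) x := by
  obtain ⟨m, hm⟩ := s.1.exists_minimal s.2.nonempty
  refine ⟨m, hm.prop, fun b hb => ?_⟩
  rcases s.2.isChain.total hm.prop hb with h | h
  · exact h
  · exact hm.le_of_le hb h

/-- The minimum of a chain. -/
def NChain.min {n : ℤ} (s : NChain X n) : X := s.exists_isLeast.choose

theorem NChain.min_isLeast {n : ℤ} (s : NChain X n) : IsLeast (s.1 : Set X) s.min :=
  s.exists_isLeast.choose_spec

variable (F : X ⥤ AddCommGrpCat.{v})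

/-- `C_n(X; F)`, the direct sum of the groups `F (min σ)` over the `n`-chains `σ` of `X`. -/
abbrev ChainGroup (n : ℤ) : Type max u v := DirectSum (NChain X n) fun s => F.obj s.min

open Classical in
/-- The inclusion of the summand of `s` into `C_n(X; F)`. -/
def ofChain {n : ℤ} (s : NChain X n) : F.obj s.min →+ ChainGroup F n :=
  DirectSum.of (fun s : NChain X n => F.obj s.min) s

open Classical in
/-- The homomorphism out of `C_n(X; F)` with given restrictions to the summands. -/
def descChain {n : ℤ} {G : Type*} [AddCommGroup G] (f : ∀ s : NChain X n, F.obj s.min →+ G) :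
    ChainGroup F n →+ G :=
  DirectSum.toAddMonoid f

@[simp]
theorem descChain_of {n : ℤ} {G : Type*} [AddCommGroup G]
    (f : ∀ s : NChain X n, F.obj s.min →+ G) (s : NChain X n) (l : F.obj s.min) :
    descChain F f (ofChain F s l) = f s l := by
  classical
  exact DirectSum.toAddMonoid_of _ _ _

theorem chainGroup_hom_ext {n : ℤ} {G : Type*} [AddCommGroup G] {f g : ChainGroup F n →+ G}
    (h : ∀ (s : NChain X n) (l : F.obj s.min), f (ofChain F s l) = g (ofChain F s l)) : f = g := by
  classical
  exact DirectSum.addHom_ext h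

open Classical in
/-- If `t` is an `n`-chain and `x ≤ min t`, this is the homomorphism `F x → C_n(X; F)` that sends
`a` to `F (x ≤ min t) a` in the summand of `t`. By convention it is `0` in all other cases. -/
def toChain (n : ℤ) (x : X) (t : Finset X) : F.obj x →+ ChainGroup F n :=
  if h : IsNChain n t ∧ ∀ b ∈ t, x ≤ b then
    (ofChain F ⟨t, h.1⟩).comp
      (F.map (homOfLE (h.2 _ (NChain.min_isLeast ⟨t, h.1⟩).1))).hom
  else 0

open Classical in
/-- The sign `(-1) ^ i` of the face of `s = {s₀ < ⋯ < sₙ}` obtained by removing `a = sᵢ`. -/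
def faceSign (s : Finset X) (a : X) : ℤ := (-1) ^ (s.filter (· < a)).card

open Classical in
/-- The differential: an element `λ` of the summand `F (min σ)` of `σ = {σ₀ < ⋯ < σₙ}` is sent to
`∑ i, (-1) ^ i • F (min σ ≤ min (σ - {σᵢ})) λ`, the `i`-th term being in the summand of
`σ - {σᵢ}`. (It is automatically zero unless `m + 1 = n`.) -/
def chainD (n m : ℤ) : ChainGroup F n →+ ChainGroup F m :=
  descChain F fun s : NChain X n =>
    ∑ a ∈ s.1, faceSign s.1 a • toChain F m s.min (s.1.erase a)

theorem toChain_of_not {n : ℤ} {x : X} {t : Finset X}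
    (h : ¬ (IsNChain n t ∧ ∀ b ∈ t, x ≤ b)) : toChain F n x t = 0 := by
  rw [toChain, dif_neg h]

theorem toChain_apply {n : ℤ} {x : X} {t : Finset X} (h : IsNChain n t) (hx : ∀ b ∈ t, x ≤ b)
    (l : F.obj x) : toChain F n x t l =
      ofChain F ⟨t, h⟩ (F.map (homOfLE (hx _ (NChain.min_isLeast ⟨t, h⟩).1)) l) := by
  rw [toChain, dif_pos ⟨h, hx⟩]
  rfl

theorem toChain_map {n : ℤ} {x y : X} (hxy : x ≤ y) {t : Finset X} (hy : ∀ b ∈ t, y ≤ b)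
    (l : F.obj x) : toChain F n y t (F.map (homOfLE hxy) l) = toChain F n x t l := by
  by_cases h : IsNChain n t
  · rw [toChain_apply F h hy, toChain_apply F h (fun b hb => hxy.trans (hy b hb)),
      ← ConcreteCategory.comp_apply, ← F.map_comp]
    rfl
  · rw [toChain_of_not F (fun h' => h h'.1), toChain_of_not F (fun h' => h h'.1)]
    rfl

theorem chainD_of [DecidableEq X] {n m : ℤ} (s : NChain X n) (l : F.obj s.min) :
    chainD F n m (ofChain F s l) =
      ∑ a ∈ s.1, faceSign s.1 a • toChain F m s.min (s.1.erase a) l := by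
  rw [chainD, descChain_of, AddMonoidHom.finsetSum_apply]
  refine Finset.sum_congr rfl fun a _ => ?_
  rw [AddMonoidHom.smul_apply]
  congr! 4

theorem chainD_toChain [DecidableEq X] {n m : ℤ} {x : X} {t : Finset X}
    (hc : IsChain (· ≤ ·) (t : Set X)) (hn : (t.card : ℤ) = n + 1) (hx : ∀ b ∈ t, x ≤ b)
    (l : F.obj x) :
    chainD F n m (toChain F n x t l) =
      ∑ a ∈ t, faceSign t a • toChain F m x (t.erase a) l := by
  rcases t.eq_empty_or_nonempty with rfl | hne
  · rw [toChain_of_not F (fun h => by simpa using h.1.nonempty)]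
    simp
  · have ht : IsNChain n t := ⟨hne, hc, hn⟩
    rw [toChain_apply F ht hx, chainD_of]
    refine Finset.sum_congr rfl fun a _ => ?_
    rw [toChain_map]
    intro b hb
    exact (NChain.min_isLeast ⟨t, ht⟩).2 (Finset.mem_of_mem_erase hb)

open Classical in
theorem faceSign_swap {s : Finset X} (hc : IsChain (· ≤ ·) (s : Set X)) {a b : X}
    (ha : a ∈ s) (hb : b ∈ s) (hab : a ≠ b) :
    faceSign s a * faceSign (s.erase a) b = - (faceSign s b * faceSign (s.erase b) a) := by
  wlog hlt : a < b generalizing a b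
  · have hba : b < a := by
      rcases hc.total ha hb with h | h
      · exact absurd (lt_of_le_of_ne h hab) hlt
      · exact lt_of_le_of_ne h hab.symm
    rw [this hb ha hab.symm hba, neg_neg]
  · have h1 : (s.erase b).filter (· < a) = s.filter (· < a) := by
      ext c
      simp only [Finset.mem_filter, Finset.mem_erase]
      constructor
      · rintro ⟨⟨_, h⟩, h'⟩
        exact ⟨h, h'⟩
      · rintro ⟨h, h'⟩
        exact ⟨⟨(h'.trans hlt).ne, h⟩, h'⟩
    have h2 : (s.erase a).filter (· < b) = (s.filter (· < b)).erase a := by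
      ext c
      simp only [Finset.mem_filter, Finset.mem_erase]
      tauto
    have h3 : ((s.filter (· < b)).erase a).card + 1 = (s.filter (· < b)).card :=
      Finset.card_erase_add_one (by simp [ha, hlt])
    simp only [faceSign]
    rw [h1, h2, ← h3, pow_succ]
    ring

theorem chainD_comp_chainD {i j k : ℤ} (hij : j + 1 = i) :
    (chainD F j k).comp (chainD F i j) = 0 := by
  classical
  refine chainGroup_hom_ext F fun s l => ?_
  have key : ∀ a ∈ s.1, chainD F j k (faceSign s.1 a • toChain F j s.min (s.1.erase a) l) =
      ∑ b ∈ s.1.erase a, (faceSign s.1 a * faceSign (s.1.erase a) b) •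
        toChain F k s.min ((s.1.erase a).erase b) l := by
    intro a ha
    have hcard := Finset.card_erase_add_one ha
    have hs := s.2.card_eq
    rw [map_zsmul, chainD_toChain F (s.2.isChain.mono (by simp)) (by lia)
      (fun b hb => s.min_isLeast.2 (Finset.mem_of_mem_erase hb)), Finset.smul_sum]
    simp only [mul_smul]
  rw [AddMonoidHom.comp_apply, chainD_of, map_sum, Finset.sum_congr rfl key, Finset.sum_sigma']
  rw [AddMonoidHom.zero_apply]
  refine Finset.sum_involution (fun p _ => ⟨p.2, p.1⟩) ?_ ?_ ?_ ?_
  · rintro ⟨a, b⟩ h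
    simp only [Finset.mem_sigma, Finset.mem_erase] at h
    dsimp only
    rw [faceSign_swap s.2.isChain h.1 h.2.2 (Ne.symm h.2.1), neg_smul, Finset.erase_right_comm,
      neg_add_cancel]
  · rintro ⟨a, b⟩ h _ heq
    simp only [Finset.mem_sigma, Finset.mem_erase] at h
    exact h.2.1 (congrArg Sigma.fst heq)
  · rintro ⟨a, b⟩ h
    simp only [Finset.mem_sigma, Finset.mem_erase] at h ⊢
    exact ⟨h.2.2, Ne.symm h.2.1, h.1⟩
  · rintro ⟨a, b⟩ h
    rfl

theorem chainD_shape {i j : ℤ} (hij : ¬ j + 1 = i) : chainD F i j = 0 := by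
  classical
  refine chainGroup_hom_ext F fun s l => ?_
  rw [chainD_of]
  refine Finset.sum_eq_zero fun a ha => ?_
  rw [toChain_of_not]
  · simp
  · intro h
    have hcard := Finset.card_erase_add_one ha
    have hs := s.2.card_eq
    have ht := h.1.card_eq
    lia

/-- The chain complex `C(X; F)`. -/
def chainComplex : ChainComplex AddCommGrpCat.{max u v} ℤ where
  X n := AddCommGrpCat.of (ChainGroup F n)
  d n m := AddCommGrpCat.ofHom (chainD F n m)
  shape i j hij := by
    rw [chainD_shape F (by simpa using hij)]
    rfl
  d_comp_d' i j k hij _ := by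
    rw [← AddCommGrpCat.ofHom_comp, chainD_comp_chainD F (by simpa using hij)]
    rfl

/-- The restriction of a functor on `X` to a subset `A` of `X`, with the induced order. -/
abbrev restrict (A : Set X) : A ⥤ AddCommGrpCat.{v} :=
  (Subtype.mono_coe (· ∈ A)).functor ⋙ F

/-- The inclusion `C_n(A; F|A) → C_n(X; F)`: the summand of a chain `σ` of `A` is mapped
identically to the summand of `σ` regarded as a chain of `X`. -/
def inclHom (A : Set X) (n : ℤ) : ChainGroup (restrict F A) n →+ ChainGroup F n :=
  descChain (restrict F A) fun s : NChain A n =>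
    toChain F n (s.min : X) (s.1.map (Function.Embedding.subtype (· ∈ A)))

@[simp]
theorem inclHom_of (A : Set X) {n : ℤ} (s : NChain A n) (l : (restrict F A).obj s.min) :
    inclHom F A n (ofChain (restrict F A) s l) =
      toChain F n (s.min : X) (s.1.map (Function.Embedding.subtype (· ∈ A))) l :=
  descChain_of _ _ _ _

theorem IsNChain.map_subtype {A : Set X} {n : ℤ} {t : Finset A} :
    IsNChain n (t.map (Function.Embedding.subtype (· ∈ A))) ↔ IsNChain n t := by
  constructor
  · rintro ⟨h1, h2, h3⟩
    refine ⟨by simpa using h1, fun a ha b hb hab => ?_, by simpa using h3⟩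
    exact h2 (by simpa using ha) (by simpa using hb) (fun h => hab (Subtype.ext h))
  · rintro ⟨h1, h2, h3⟩
    refine ⟨by simpa using h1, ?_, by simpa using h3⟩
    rintro a ha b hb hab
    simp only [Finset.coe_map, Set.mem_image] at ha hb
    obtain ⟨a, ha, rfl⟩ := ha
    obtain ⟨b, hb, rfl⟩ := hb
    exact h2 ha hb (fun h => hab (congrArg _ h))

theorem inclHom_toChain (A : Set X) {n : ℤ} {x : A} {t : Finset A} (hx : ∀ b ∈ t, x ≤ b)
    (l : (restrict F A).obj x) :
    inclHom F A n (toChain (restrict F A) n x t l) =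
      toChain F n (x : X) (t.map (Function.Embedding.subtype (· ∈ A))) l := by
  by_cases h : IsNChain n t
  · rw [toChain_apply (restrict F A) h hx, inclHom_of]
    refine toChain_map F (Subtype.coe_le_coe.2 (hx _ (NChain.min_isLeast ⟨t, h⟩).1)) ?_ l
    intro b hb
    simp only [Finset.mem_map] at hb
    obtain ⟨b, hb, rfl⟩ := hb
    exact (NChain.min_isLeast ⟨t, h⟩).2 hb
  · rw [toChain_of_not _ (fun h' => h h'.1),
      toChain_of_not _ (fun h' => h (IsNChain.map_subtype.1 h'.1))]
    exact map_zero (inclHom F A n)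

theorem faceSign_map (A : Set X) (t : Finset A) (a : A) :
    faceSign (t.map (Function.Embedding.subtype (· ∈ A))) (a : X) = faceSign t a := by
  classical
  simp only [faceSign]
  congr 1
  rw [Finset.filter_map, Finset.card_map]
  congr 1

theorem inclHom_comp_chainD (A : Set X) (i j : ℤ) :
    (chainD F i j).comp (inclHom F A i) = (inclHom F A j).comp (chainD (restrict F A) i j) := by
  classical
  refine chainGroup_hom_ext _ fun s l => ?_
  have hs := IsNChain.map_subtype.2 s.2
  rw [AddMonoidHom.comp_apply, AddMonoidHom.comp_apply, inclHom_of, chainD_of, map_sum]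
  refine (chainD_toChain F hs.isChain hs.card_eq ?_ _).trans ?_
  rotate_left
  · rw [Finset.sum_map]
    refine Finset.sum_congr rfl fun a ha => ?_
    rw [map_zsmul, inclHom_toChain]
    · congr 1
      · exact faceSign_map A s.1 a
      · rw [Finset.map_erase]
    · exact fun b hb => s.min_isLeast.2 (Finset.mem_of_mem_erase hb)
  · intro b hb
    simp only [Finset.mem_map] at hb
    obtain ⟨b, hb, rfl⟩ := hb
    exact s.min_isLeast.2 hb

/-- The inclusion of chain complexes `C(A; F|A) → C(X; F)`. -/
def incl (A : Set X) : chainComplex (restrict F A) ⟶ chainComplex F where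
  f n := AddCommGrpCat.ofHom (inclHom F A n)
  comm' i j _ := by
    change AddCommGrpCat.ofHom _ ≫ AddCommGrpCat.ofHom _ =
      AddCommGrpCat.ofHom _ ≫ AddCommGrpCat.ofHom _
    rw [← AddCommGrpCat.ofHom_comp, ← AddCommGrpCat.ofHom_comp,
      inclHom_comp_chainD F A]

/-- The quotient complex `C(X, A; F) = C(X; F) / C(A; F|A)`. -/
def relativeComplex (A : Set X) : ChainComplex AddCommGrpCat.{max u v} ℤ :=
  Limits.cokernel (incl F A)

/-- The homology group `H_n(X, A; F)`. -/
def relativeHomology (A : Set X) (n : ℤ) : AddCommGrpCat.{max u v} :=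
  (relativeComplex F A).homology n

end Chains

/-! ### The cube complex of a functor on a finite Boolean lattice -/

section Cube

variable {L : Type u} [BooleanAlgebra L]

/-- The rank of `x`: the greatest length `l` of a chain `x₀ < ⋯ < x_l = x`. -/
def rank (x : L) : ℕ := (Order.height x).toNat

theorem exists_atom_of_covBy {x y : L} (h : x ⋖ y) :
    IsAtom (y \ x) ∧ y = x ⊔ y \ x ∧ ∀ a, IsAtom a → a ≤ y → ¬ a ≤ x → a = y \ x := by
  have hat : IsAtom (y \ x) := by
    rw [← bot_covBy_iff]
    refine ⟨bot_lt_iff_ne_bot.2 fun h0 => h.lt.not_ge (sdiff_eq_bot_iff.1 h0), fun c hc hc' => ?_⟩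
    have hdis : Disjoint c x := disjoint_sdiff_self_left.mono_left hc'.le
    have h1 : x < x ⊔ c := left_lt_sup.2 fun hcx => hc.ne' (hdis.eq_bot_of_le hcx)
    refine h.2 h1 (lt_of_le_of_ne (sup_le h.le (hc'.le.trans sdiff_le)) fun h2 => hc'.ne ?_)
    rw [← h2, sup_sdiff_left_self, hdis.sdiff_eq_left]
  refine ⟨hat, (sup_sdiff_cancel_right h.le).symm, fun a ha hay hax => ?_⟩
  have hdis : Disjoint a x := IsAtom.not_le_iff_disjoint ha |>.1 hax
  exact (hat.le_iff.1 (le_sdiff.2 ⟨hay, hdis⟩)).resolve_left ha.1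

section Sign

variable {n : ℕ} (e : Fin n ≃ {a : L // IsAtom a})

open Classical in
/-- The `j`-th coordinate of `x` under the isomorphism `L ≅ {0,1}ⁿ` that is determined by the
enumeration `e` of the atoms of `L`. -/
def coord (x : L) (j : Fin n) : ℕ := if (e j : L) ≤ x then 1 else 0

theorem existsUnique_coord {x y : L} (h : x ⋖ y) :
    ∃! m : Fin n, coord e x m = 0 ∧ coord e y m = 1 := by
  obtain ⟨h1, h2, h3⟩ := exists_atom_of_covBy h
  refine ⟨e.symm ⟨_, h1⟩, ?_, fun m hm => ?_⟩
  · have : ¬ y \ x ≤ x := fun hle => h1.1 (disjoint_sdiff_self_left.eq_bot_of_le hle)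
    simp [coord, this]
  · simp only [coord, ite_eq_right_iff, one_ne_zero, imp_false, ite_eq_left_iff, zero_ne_one,
      not_not] at hm
    rw [Equiv.eq_symm_apply]
    exact Subtype.ext (h3 _ (e m).2 hm.2 hm.1)

/-- The unique coordinate in which `x` and `y` differ when `y` covers `x`. -/
def coverIndex {x y : L} (h : x ⋖ y) : Fin n := (existsUnique_coord e h).choose

/-- The sign `ε(x ≺ y)` of a cover relation: the product of `(-1) ^ (x_j)` over all coordinates `j`
up to the one in which `x` and `y` differ. -/
def coverSign {x y : L} (h : x ⋖ y) : ℤ := ∏ j ∈ Finset.Iic (coverIndex e h), (-1) ^ coord e x j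

theorem coord_eq_one_iff {x : L} {j : Fin n} : coord e x j = 1 ↔ (e j : L) ≤ x := by
  simp [coord]

theorem coord_eq_zero_iff {x : L} {j : Fin n} : coord e x j = 0 ↔ ¬ (e j : L) ≤ x := by
  simp [coord]

theorem coverIndex_spec {x y : L} (h : x ⋖ y) :
    ¬ (e (coverIndex e h) : L) ≤ x ∧ (e (coverIndex e h) : L) ≤ y := by
  rw [← coord_eq_zero_iff, ← coord_eq_one_iff]
  exact (existsUnique_coord e h).choose_spec.1

theorem eq_coverIndex {x y : L} (h : x ⋖ y) {m : Fin n} (h1 : ¬ (e m : L) ≤ x)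
    (h2 : (e m : L) ≤ y) : m = coverIndex e h :=
  (existsUnique_coord e h).choose_spec.2 m
    ⟨(coord_eq_zero_iff e).2 h1, (coord_eq_one_iff e).2 h2⟩

theorem coord_covBy {x y : L} (h : x ⋖ y) (j : Fin n) :
    coord e y j = coord e x j + if j = coverIndex e h then 1 else 0 := by
  split_ifs with hj
  · subst hj
    rw [(coord_eq_one_iff e).2 (coverIndex_spec e h).2,
      (coord_eq_zero_iff e).2 (coverIndex_spec e h).1]
  · by_cases h1 : (e j : L) ≤ x
    · rw [(coord_eq_one_iff e).2 h1, (coord_eq_one_iff e).2 (h1.trans h.le)]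
    · rw [(coord_eq_zero_iff e).2 h1,
        (coord_eq_zero_iff e).2 (fun h2 => hj (eq_coverIndex e h h1 h2))]

theorem coverSign_mul {x y z : L} (h : x ⋖ y) (h' : y ⋖ z) :
    coverSign e h * coverSign e h' =
      (∏ j ∈ Finset.Iic (coverIndex e h), (-1) ^ coord e x j) *
      (∏ j ∈ Finset.Iic (coverIndex e h'), (-1) ^ coord e x j) *
      (if coverIndex e h ≤ coverIndex e h' then -1 else 1) := by
  rw [coverSign, coverSign, mul_assoc]
  congr 1
  simp only [coord_covBy e h, pow_add, Finset.prod_mul_distrib]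
  congr 1
  simp only [pow_ite, pow_one, pow_zero]
  rw [Finset.prod_ite_eq']
  simp

/-- The element other than `y` between `x` and `z`, if `x ⋖ y ⋖ z`. -/
def flip (x z y : L) : L := x ⊔ z \ y

theorem inf_flip {x y z : L} (h : x ≤ y) : y ⊓ flip x z y = x := by
  rw [flip, inf_sup_left, inf_sdiff_self_right, sup_bot_eq, inf_eq_right.2 h]

theorem sup_flip {x y z : L} (h : x ≤ y) (h' : y ≤ z) : y ⊔ flip x z y = z := by
  rw [flip, ← sup_assoc, sup_eq_left.2 h, sup_sdiff_cancel_right h']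

theorem flip_flip {x y z : L} (h : x ≤ y) (h' : y ≤ z) : flip x z (flip x z y) = y := by
  rw [flip, flip, sdiff_sup, sdiff_sdiff_right_self, sup_inf_left,
    sup_sdiff_cancel_right (h.trans h'), inf_eq_right.2 h', sup_eq_right.2 h, inf_eq_right.2 h']

theorem flip_ne {x y z : L} (h : x ⋖ y) : flip x z y ≠ y := by
  intro heq
  have := inf_flip (z := z) h.le
  rw [heq, inf_idem] at this
  exact h.ne' this

theorem covBy_flip {x y z : L} (h : x ⋖ y) (h' : y ⋖ z) : x ⋖ flip x z y := by
  have h1 := inf_flip (z := z) h.le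
  have h2 := sup_flip h.le h'.le
  rw [← h2] at h'
  have := h'.inf_of_sup_left
  rwa [h1] at this

theorem flip_covBy {x y z : L} (h : x ⋖ y) (h' : y ⋖ z) : flip x z y ⋖ z := by
  have h1 := inf_flip (z := z) h.le
  have h2 := sup_flip h.le h'.le
  rw [← h1] at h
  have := h.sup_of_inf_left
  rwa [h2] at this

theorem coverSign_flip {x y z : L} (h : x ⋖ y) (h' : y ⋖ z) :
    coverSign e (covBy_flip h h') * coverSign e (flip_covBy h h') =
      - (coverSign e h * coverSign e h') := by
  have hm := coverIndex_spec e h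
  have hk := coverIndex_spec e h'
  have h1 : coverIndex e h' = coverIndex e (covBy_flip h h') := by
    refine eq_coverIndex e _ (fun hle => hk.1 (hle.trans h.le)) ?_
    exact (le_sdiff.2 ⟨hk.2, (IsAtom.not_le_iff_disjoint (e _).2).1 hk.1⟩).trans le_sup_right
  have h2 : coverIndex e h = coverIndex e (flip_covBy h h') := by
    refine eq_coverIndex e _ (fun hle => hm.1 ?_) (hm.2.trans h'.le)
    exact (le_inf hm.2 hle).trans (inf_flip h.le).le
  have hne : coverIndex e h ≠ coverIndex e h' := fun heq => hk.1 (heq ▸ hm.2)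
  rw [coverSign_mul, coverSign_mul, ← h1, ← h2]
  rcases lt_or_gt_of_ne hne with hlt | hlt
  · rw [if_neg hlt.not_ge, if_pos hlt.le]
    ring
  · rw [if_pos hlt.le, if_neg hlt.not_ge]
    ring

end Sign

theorem ncard_atoms_covBy [Finite L] {x y : L} (h : x ⋖ y) :
    {a | IsAtom a ∧ a ≤ y}.ncard = {a | IsAtom a ∧ a ≤ x}.ncard + 1 := by
  obtain ⟨h1, h2, h3⟩ := exists_atom_of_covBy h
  have : {a | IsAtom a ∧ a ≤ y} = insert (y \ x) {a | IsAtom a ∧ a ≤ x} := by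
    ext a
    simp only [Set.mem_ofPred_eq, Set.mem_insert_iff]
    constructor
    · rintro ⟨ha, hay⟩
      by_cases hax : a ≤ x
      · exact Or.inr ⟨ha, hax⟩
      · exact Or.inl (h3 a ha hay hax)
    · rintro (rfl | ⟨ha, hax⟩)
      · exact ⟨h1, sdiff_le⟩
      · exact ⟨ha, hax.trans h.le⟩
  rw [this, Set.ncard_insert_of_notMem]
  rintro ⟨-, hle⟩
  exact h1.1 (disjoint_sdiff_self_left.eq_bot_of_le hle)

theorem height_eq_ncard_atoms [Finite L] (x : L) :
    Order.height x = ({a | IsAtom a ∧ a ≤ x}.ncard : ℕ∞) := by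
  induction x using WellFoundedLT.induction with
  | _ x ih =>
    apply le_antisymm
    · rw [Order.height_le_coe_iff]
      intro y hy
      rw [ih y hy]
      obtain ⟨z, hyz, hzx⟩ := hy.exists_covby_le
      have h1 := ncard_atoms_covBy hyz
      have h2 : {a | IsAtom a ∧ a ≤ z}.ncard ≤ {a | IsAtom a ∧ a ≤ x}.ncard :=
        Set.ncard_le_ncard (fun a ha => ⟨ha.1, ha.2.trans hzx⟩) (Set.toFinite _)
      exact_mod_cast (by lia)
    · rcases eq_or_ne x ⊥ with rfl | hx
      · have : {a : L | IsAtom a ∧ a ≤ ⊥} = ∅ := by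
          ext a
          simp only [le_bot_iff, Set.mem_ofPred_eq, Set.mem_empty_iff_false, iff_false]
          exact fun ha => ha.1.1 ha.2
        rw [this]
        simp
      · obtain ⟨y, -, hyx⟩ := exists_le_covBy_of_lt (bot_lt_iff_ne_bot.2 hx)
        rw [ncard_atoms_covBy hyx, Nat.cast_add, ← ih y hyx.lt]
        exact Order.height_add_one_le hyx.lt

theorem rank_eq_ncard_atoms [Finite L] (x : L) : rank x = {a | IsAtom a ∧ a ≤ x}.ncard := by
  rw [rank, height_eq_ncard_atoms, ENat.toNat_natCast]

theorem rank_covBy [Finite L] {x y : L} (h : x ⋖ y) : rank y = rank x + 1 := by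
  rw [rank_eq_ncard_atoms, rank_eq_ncard_atoms, ncard_atoms_covBy h]

variable (L) in
/-- The elements of rank `r - i`, where `r` is the rank of `L`. -/
abbrev Vertex (i : ℤ) : Type u := {x : L // (rank x : ℤ) = rank (⊤ : L) - i}

variable (F : L ⥤ AddCommGrpCat.{v})

/-- The group `K_i(L, F)`, the direct sum of the groups `F x` over the elements `x` of rank
`r - i`. -/
abbrev CubeGroup (i : ℤ) : Type max u v := DirectSum (Vertex L i) fun x => F.obj x.1

open Classical in
/-- The inclusion of the summand of `x` into `K_i(L, F)`. -/
def ofVertex {i : ℤ} (x : Vertex L i) : F.obj x.1 →+ CubeGroup F i :=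
  DirectSum.of (fun x : Vertex L i => F.obj x.1) x

theorem cubeGroup_hom_ext {i : ℤ} {G : Type*} [AddCommGroup G] {f g : CubeGroup F i →+ G}
    (h : ∀ (x : Vertex L i) (l : F.obj x.1), f (ofVertex F x l) = g (ofVertex F x l)) : f = g := by
  classical
  exact DirectSum.addHom_ext h

variable [Finite L] {n : ℕ} (e : Fin n ≃ {a : L // IsAtom a})

open Classical in
/-- The differential of the cube complex: an element `λ` of the summand `F x` is sent to
`∑ ε(x ≺ y) • F (x ≤ y) λ`, the sum being over the elements `y` that cover `x`, and the `y`-th term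
being in the summand of `y`. (It is automatically zero unless `j + 1 = i`.) -/
def cubeD (i j : ℤ) : CubeGroup F i →+ CubeGroup F j :=
  letI := Fintype.ofFinite (Vertex L j)
  DirectSum.toAddMonoid fun x : Vertex L i =>
    ∑ y : Vertex L j, if h : x.1 ⋖ y.1 then
      coverSign e h • (ofVertex F y).comp (F.map (homOfLE h.le)).hom else 0

open Classical in
theorem cubeD_of {i j : ℤ} [Fintype (Vertex L j)] (x : Vertex L i) (l : F.obj x.1) :
    cubeD F e i j (ofVertex F x l) =
      ∑ y : Vertex L j, if h : x.1 ⋖ y.1 then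
        coverSign e h • ofVertex F y (F.map (homOfLE h.le) l) else 0 := by
  rw [cubeD, ofVertex, DirectSum.toAddMonoid_of, AddMonoidHom.finsetSum_apply]
  refine Finset.sum_congr (by congr!) fun y _ => ?_
  split_ifs <;> rfl

theorem cubeD_shape {i j : ℤ} (hij : ¬ j + 1 = i) : cubeD F e i j = 0 := by
  classical
  let _ := Fintype.ofFinite (Vertex L j)
  refine cubeGroup_hom_ext F fun x l => ?_
  rw [cubeD_of]
  refine Finset.sum_eq_zero fun y _ => dif_neg fun h => hij ?_
  have h1 := rank_covBy h
  have h2 := x.2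
  have h3 := y.2
  lia

theorem cubeD_comp_cubeD (i j k : ℤ) : (cubeD F e j k).comp (cubeD F e i j) = 0 := by
  classical
  let _ := Fintype.ofFinite (Vertex L j)
  let _ := Fintype.ofFinite (Vertex L k)
  refine cubeGroup_hom_ext F fun x l => ?_
  rw [AddMonoidHom.comp_apply, cubeD_of, map_sum, AddMonoidHom.zero_apply]
  have key : ∀ y : Vertex L j,
      cubeD F e j k (if h : x.1 ⋖ y.1 then
        coverSign e h • ofVertex F y (F.map (homOfLE h.le) l) else 0) =
      ∑ z : Vertex L k, if h : x.1 ⋖ y.1 ∧ y.1 ⋖ z.1 then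
        (coverSign e h.1 * coverSign e h.2) •
          ofVertex F z (F.map (homOfLE (h.1.le.trans h.2.le)) l) else 0 := by
    intro y
    by_cases h : x.1 ⋖ y.1
    · rw [dif_pos h, map_zsmul, cubeD_of, Finset.smul_sum]
      refine Finset.sum_congr rfl fun z _ => ?_
      by_cases h' : y.1 ⋖ z.1
      · rw [dif_pos h', dif_pos ⟨h, h'⟩, mul_smul, ← ConcreteCategory.comp_apply, ← F.map_comp]
        rfl
      · rw [dif_neg h', dif_neg (fun h'' => h' h''.2), smul_zero]
    · rw [dif_neg h, map_zero]
      exact (Finset.sum_eq_zero fun z _ => dif_neg fun h'' => h h''.1).symm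
  rw [Finset.sum_congr rfl fun y _ => key y, Finset.sum_comm]
  refine Finset.sum_eq_zero fun z _ => ?_
  rw [← Finset.sum_filter_of_ne (p := fun y : Vertex L j => x.1 ⋖ y.1 ∧ y.1 ⋖ z.1)
    (fun y _ hy => by
      by_contra hc
      exact hy (dif_neg hc))]
  have hmem : ∀ y : Vertex L j, y ∈ (Finset.univ : Finset (Vertex L j)).filter
      (fun y => x.1 ⋖ y.1 ∧ y.1 ⋖ z.1) → x.1 ⋖ y.1 ∧ y.1 ⋖ z.1 :=
    fun y hy => (Finset.mem_filter.1 hy).2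
  refine Finset.sum_involution (fun y hy => ⟨flip x.1 z.1 y.1, ?_⟩) ?_ ?_ ?_ ?_
  · obtain ⟨h, h'⟩ := hmem y hy
    have h1 := rank_covBy h
    have h2 := rank_covBy (covBy_flip h h')
    have h3 := y.2
    lia
  · intro y hy
    obtain ⟨h, h'⟩ := hmem y hy
    rw [dif_pos ⟨h, h'⟩, dif_pos ⟨covBy_flip h h', flip_covBy h h'⟩, coverSign_flip e h h',
      neg_smul, add_neg_cancel]
  · intro y hy _ heq
    exact flip_ne (hmem y hy).1 (congrArg Subtype.val heq)
  · intro y hy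
    obtain ⟨h, h'⟩ := hmem y hy
    exact Finset.mem_filter.2 ⟨Finset.mem_univ _, covBy_flip h h', flip_covBy h h'⟩
  · intro y hy
    obtain ⟨h, h'⟩ := hmem y hy
    exact Subtype.ext (flip_flip h.le h'.le)

/-- Khovanov's cube complex `K_*(L, F)`, with respect to an enumeration `e` of the atoms of `L`. -/
def cubeComplex : ChainComplex AddCommGrpCat.{max u v} ℤ where
  X i := AddCommGrpCat.of (CubeGroup F i)
  d i j := AddCommGrpCat.ofHom (cubeD F e i j)
  shape i j hij := by
    rw [cubeD_shape F e (by simpa using hij)]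
    rfl
  d_comp_d' i j k _ _ := by
    rw [← AddCommGrpCat.ofHom_comp, cubeD_comp_cubeD F e]
    rfl

end Cube

end PosetHomology

end

/-! The proof compares two homological functors of the coefficients `F`. A chain of `L` lies in `L -
{⊤}` exactly when it omits `⊤`, so the relative complex is the complex of chains that contain `⊤`
(`relativeComplexIso`). In each degree, this complex and the cube complex are direct sums of values
of `F`; hence both are exact in `F`, and a short exact sequence of functors yields long exact
homology sequences.

In degree zero both homology groups are quotients of `F ⊤`. The chains `{x < ⊤}` kill the images of
all `F x` with `x ≠ ⊤`, the cube only those of coatoms; these generate the same subgroup because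
every `x ≠ ⊤` lies below a coatom. This gives a natural isomorphism (`nonempty_homology_zero_iso`).

Every `F` is a quotient of a finite sum of functors `induced x A`, constant with value `A` above `x`
and zero elsewhere. For these, both complexes have no homology in positive degrees. If `x = ⊤`, both
are concentrated in degree zero. If `x ≠ ⊤`, deleting an atom not below `x` contracts the cube
complex (`cubeContraction_spec`), and inserting `x` into chains contracts the other
(`topContraction_spec`).

Dimension shifting (`nonempty_homology_iso_of_effaceable`) then carries the isomorphism from degree
zero to all positive degrees. In negative degrees both complexes vanish. -/

noncomputable section

namespace PosetHomology

/-! ### Dimension shifting -/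

section DimensionShifting

open Limits

universe u₁ v₁ u₂ v₂

variable {C : Type u₁} [Category.{v₁} C] [Abelian C] {D : Type u₂} [Category.{v₂} D] [Abelian D]

/-- The first homology of an exact functor to chain complexes, as a kernel of a map between zeroth
homology objects, if the middle term of a short exact sequence has no first homology. -/
def homologyOneIsoKernel (T : C ⥤ ChainComplex D ℤ) [T.PreservesZeroMorphisms]
    {S : ShortComplex C} (hS : (S.map T).ShortExact) (h : IsZero ((T.obj S.X₂).homology 1)) :
    (T.obj S.X₃).homology 1 ≅
      kernel (HomologicalComplex.homologyMap (T.map S.f) 0) :=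
  have hrel : (ComplexShape.down ℤ).Rel 1 0 := by simp
  have : Mono (ShortComplex.mk _ _ (hS.δ_comp 1 0 hrel)).f := hS.mono_δ 1 0 hrel h
  (hS.homology_exact₁ 1 0 hrel).fIsKernel.conePointUniqueUpToIso
    (limit.isLimit (parallelPair (HomologicalComplex.homologyMap (T.map S.f) 0) 0))

/-- Two exact functors to chain complexes whose zeroth homology functors are isomorphic and
whose higher homology is effaced by common objects have isomorphic homology. -/
theorem nonempty_homology_iso_of_effaceable (T T' : C ⥤ ChainComplex D ℤ)
    [T.PreservesZeroMorphisms] [T'.PreservesZeroMorphisms]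
    (hT : ∀ S : ShortComplex C, S.ShortExact → (S.map T).ShortExact)
    (hT' : ∀ S : ShortComplex C, S.ShortExact → (S.map T').ShortExact)
    (hP : ∀ F : C, ∃ (P : C) (p : P ⟶ F), Epi p ∧
      ∀ n : ℤ, 0 < n → IsZero ((T.obj P).homology n) ∧ IsZero ((T'.obj P).homology n))
    (φ : T ⋙ HomologicalComplex.homologyFunctor D (ComplexShape.down ℤ) 0 ≅
      T' ⋙ HomologicalComplex.homologyFunctor D (ComplexShape.down ℤ) 0) (n : ℕ) (F : C) :
    Nonempty ((T.obj F).homology n ≅ (T'.obj F).homology n) := by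
  induction n generalizing F with
  | zero => exact ⟨φ.app F⟩
  | succ n ih =>
    obtain ⟨P, p, hp, h⟩ := hP F
    let S : ShortComplex C := ShortComplex.mk (kernel.ι p) p (kernel.condition p)
    have hS : S.ShortExact :=
      { exact := ShortComplex.exact_of_f_is_kernel _ (kernelIsKernel p)
        mono_f := inferInstanceAs (Mono (kernel.ι p))
        epi_g := hp }
    -- Degree one is special: the zeroth homology of `P` need not vanish, so the connecting map is
    -- only injective and its image is a kernel in degree zero. Naturality of `φ` is used only here;
    -- in higher degrees both connecting maps are isomorphisms and an objectwise isomorphism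
    -- suffices.
    rcases n.eq_zero_or_pos with rfl | hn
    · exact ⟨homologyOneIsoKernel T (hT S hS) (h 1 one_pos).1 ≪≫
        kernel.mapIso _ _ (φ.app _) (φ.app _) (φ.hom.naturality S.f) ≪≫
        (homologyOneIsoKernel T' (hT' S hS) (h 1 one_pos).2).symm⟩
    · obtain ⟨i⟩ := ih S.X₁
      have hn' : (0 : ℤ) < n := by exact_mod_cast hn
      have hn1 : (0 : ℤ) < (n + 1 : ℕ) := by positivity
      have hrel : (ComplexShape.down ℤ).Rel (n + 1 : ℕ) n := by simp
      exact ⟨(hT S hS).δIso _ _ hrel (h _ hn1).1 (h _ hn').1 ≪≫ i ≪≫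
        ((hT' S hS).δIso _ _ hrel (h _ hn1).2 (h _ hn').2).symm⟩

/-- The identity of a biproduct is a sum of maps that factor through the summands, and an additive
functor preserves this expression. -/
theorem isZero_obj_biproduct {C : Type u₁} [Category.{v₁} C] [Preadditive C] {D : Type u₂}
    [Category.{v₂} D] [Preadditive D] [HasFiniteBiproducts C] (T : C ⥤ D) [T.Additive]
    {J : Type*} [Finite J] (f : J → C)
    (h : ∀ j, IsZero (T.obj (f j))) : IsZero (T.obj (⨁ f)) := by
  have := Fintype.ofFinite J
  have h1 : 𝟙 (⨁ f) = ∑ j, biproduct.π f j ≫ biproduct.ι f j :=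
    (IsBilimit.total (biproduct.isBilimit f)).symm
  rw [IsZero.iff_id_eq_zero, ← T.map_id, h1, T.map_sum]
  refine Finset.sum_eq_zero fun j _ => ?_
  rw [T.map_comp, (h j).eq_zero_of_tgt (T.map (biproduct.π f j)), zero_comp]

end DimensionShifting

/-! ### Functors induced from an element of a poset -/

section Induced

variable {X : Type u} [PartialOrder X]

/-- The functor with value `A` at the elements above `x` and `0` at all others, with inclusions of
subgroups of `A` as transition maps. -/
def induced (x : X) (A : AddCommGrpCat.{v}) : X ⥤ AddCommGrpCat.{v} where
  obj y := AddCommGrpCat.of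
    ({ carrier := {a : A | ¬ x ≤ y → a = 0}
       zero_mem' := fun _ => rfl
       add_mem' := fun ha hb h => by rw [ha h, hb h, add_zero]
       neg_mem' := fun ha h => by rw [ha h, neg_zero] } : AddSubgroup A)
  map {y z} f := AddCommGrpCat.ofHom
    (AddSubgroup.inclusion fun a (ha : ¬ x ≤ y → a = 0) h => ha fun h' => h (h'.trans (leOfHom f)))
  map_id _ := rfl
  map_comp _ _ := rfl

variable {x : X} {A : AddCommGrpCat.{v}}

/-- The element of `induced x A` at `y` given by an element of `A` that is zero unless `x ≤ y`. -/
def inducedMk {y : X} (a : A) (h : ¬ x ≤ y → a = 0) : (induced x A).obj y :=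
  (⟨a, h⟩ : {a : A // ¬ x ≤ y → a = 0})

/-- The inclusion of the value of `induced x A` at `y` into `A`. -/
def inducedVal {y : X} : (induced x A).obj y →+ A := AddSubgroup.subtype _

theorem inducedVal_injective {y : X} :
    Function.Injective (inducedVal : (induced x A).obj y →+ A) := Subtype.coe_injective

theorem inducedVal_eq_zero {y : X} (h : ¬ x ≤ y) (l : (induced x A).obj y) : inducedVal l = 0 :=
  l.2 h

theorem inducedVal_map {y z : X} (f : y ⟶ z) (l : (induced x A).obj y) :
    inducedVal ((induced x A).map f l) = inducedVal l := rfl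

theorem eq_zero_of_not_le {y : X} (h : ¬ x ≤ y) (l : (induced x A).obj y) : l = 0 :=
  inducedVal_injective ((inducedVal_eq_zero h l).trans (map_zero inducedVal).symm)

open Classical in
/-- The homomorphism from `A` to the value of `induced x A` at `y` that is the identity of `A` if
`x ≤ y` and zero otherwise. -/
def inducedOf (x y : X) (A : AddCommGrpCat.{v}) : A →+ (induced x A).obj y :=
  if h : x ≤ y then
    { toFun := fun b => inducedMk b fun h' => absurd h h'
      map_zero' := rfl
      map_add' := fun _ _ => rfl }
  else 0

theorem inducedVal_of {y : X} (h : x ≤ y) (b : A) : inducedVal (inducedOf x y A b) = b := by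
  rw [inducedOf, dif_pos h]
  rfl

theorem inducedOf_of_not_le {y : X} (h : ¬ x ≤ y) (b : A) : inducedOf x y A b = 0 := by
  rw [inducedOf, dif_neg h]
  rfl

theorem inducedOf_val {y : X} (l : (induced x A).obj y) : inducedOf x y A (inducedVal l) = l := by
  by_cases h : x ≤ y
  · exact inducedVal_injective (inducedVal_of h _)
  · rw [eq_zero_of_not_le h l, map_zero, map_zero]

theorem inducedOf_map {y z : X} (hy : x ≤ y) (f : y ⟶ z) (b : A) :
    (induced x A).map f (inducedOf x y A b) = inducedOf x z A b := by
  apply inducedVal_injective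
  rw [inducedVal_map, inducedVal_of hy, inducedVal_of (hy.trans (leOfHom f))]

open Classical in
/-- The value at `y` of the counit `induced x (F x) ⟶ F`. -/
def inducedDescApp (F : X ⥤ AddCommGrpCat.{v}) (x y : X) :
    (induced x (F.obj x)).obj y →+ F.obj y :=
  if h : x ≤ y then (F.map (homOfLE h)).hom.comp inducedVal else 0

theorem inducedDescApp_of_le (F : X ⥤ AddCommGrpCat.{v}) {x y : X} (h : x ≤ y)
    (l : (induced x (F.obj x)).obj y) :
    inducedDescApp F x y l = F.map (homOfLE h) (inducedVal l) := by
  rw [inducedDescApp, dif_pos h]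
  rfl

/-- The counit `induced x (F x) ⟶ F`. -/
def inducedDesc (F : X ⥤ AddCommGrpCat.{v}) (x : X) : induced x (F.obj x) ⟶ F where
  app y := AddCommGrpCat.ofHom (inducedDescApp F x y)
  naturality y z f := by
    ext l
    change inducedDescApp F x z ((induced x (F.obj x)).map f l) =
      F.map f (inducedDescApp F x y l)
    by_cases h : x ≤ y
    · rw [inducedDescApp_of_le F h, inducedDescApp_of_le F (h.trans (leOfHom f)), inducedVal_map,
        ← ConcreteCategory.comp_apply, ← F.map_comp]
      rfl
    · rw [eq_zero_of_not_le h l, map_zero, map_zero, map_zero, map_zero]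

/-- At `x` itself the counit is the identity of `F x`, up to the description of the induced functor
as a subgroup. -/
theorem inducedDesc_app_surjective (F : X ⥤ AddCommGrpCat.{v}) (x : X) :
    Function.Surjective ((inducedDesc F x).app x) := by
  intro a
  refine ⟨inducedMk a fun h => absurd le_rfl h, (inducedDescApp_of_le F le_rfl _).trans ?_⟩
  change F.map (𝟙 x) a = a
  rw [F.map_id]
  rfl

open Limits in
/-- Over a finite poset, each functor is a quotient of a finite sum of induced functors. -/
theorem exists_epi_of_induced [Finite X] (F : X ⥤ AddCommGrpCat.{v}) :
    ∃ (P : X ⥤ AddCommGrpCat.{v}) (p : P ⟶ F), Epi p ∧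
      ∀ (T : (X ⥤ AddCommGrpCat.{v}) ⥤ AddCommGrpCat.{max u v}) [T.Additive],
        (∀ x, IsZero (T.obj (induced x (F.obj x)))) → IsZero (T.obj P) := by
  have : HasFiniteBiproducts (X ⥤ AddCommGrpCat.{v}) := Abelian.hasFiniteBiproducts
  refine ⟨⨁ fun x => induced x (F.obj x), biproduct.desc fun x => inducedDesc F x, ?_,
    fun T _ h => isZero_obj_biproduct T _ h⟩
  rw [NatTrans.epi_iff_epi_app]
  intro x
  -- At each point `x`, the single summand induced from `x` already covers `F x`.
  have h : Epi ((inducedDesc F x).app x) :=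
    (AddCommGrpCat.epi_iff_surjective _).2 (inducedDesc_app_surjective F x)
  have hc : (biproduct.ι (fun x => induced x (F.obj x)) x).app x ≫
      (biproduct.desc fun x => inducedDesc F x).app x = (inducedDesc F x).app x := by
    rw [← NatTrans.comp_app, biproduct.ι_desc]
  have : Epi ((biproduct.ι (fun x => induced x (F.obj x)) x).app x ≫
      (biproduct.desc fun x => inducedDesc F x).app x) := hc ▸ h
  exact epi_of_epi ((biproduct.ι (fun x => induced x (F.obj x)) x).app x) _

end Induced

/-! ### Direct sums of exact sequences -/

theorem directSum_map_exact {ι : Type*} {α β γ : ι → Type*} [∀ i, AddCommGroup (α i)]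
    [∀ i, AddCommGroup (β i)] [∀ i, AddCommGroup (γ i)] (f : ∀ i, α i →+ β i)
    (g : ∀ i, β i →+ γ i) (h : ∀ i, Function.Exact (f i) (g i)) :
    Function.Exact (DirectSum.map f) (DirectSum.map g) := by
  classical
  intro b
  constructor
  · intro hb
    have hb' (i : ι) : ∃ a, f i a = b i := by
      rw [← Set.mem_range, ← h i, ← DirectSum.map_apply, hb]
      rfl
    choose a ha using hb'
    -- The chosen preimages are used only on the support of `b`, since a preimage of `0` may be
    -- nonzero and finite support has to be kept.
    refine ⟨DirectSum.mk _ b.support fun i => a i, DFinsupp.ext fun i => ?_⟩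
    refine (DirectSum.map_apply _ _ _).trans ?_
    by_cases hi : i ∈ b.support
    · rw [DirectSum.mk_apply_of_mem hi, ha]
    · rw [DirectSum.mk_apply_of_notMem hi, map_zero, DFinsupp.notMem_support_iff.1 hi]
  · rintro ⟨a, rfl⟩
    refine DFinsupp.ext fun i => ?_
    refine (DirectSum.map_apply _ _ _).trans ?_
    rw [DirectSum.map_apply]
    exact (h i).apply_apply_eq_zero _

theorem shortExact_of_exact {S : ShortComplex AddCommGrpCat.{v}} (hf : Function.Injective S.f)
    (hg : Function.Surjective S.g) (h : Function.Exact S.f S.g) : S.ShortExact where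
  exact := (ShortComplex.ab_exact_iff_function_exact S).2 h
  mono_f := (AddCommGrpCat.mono_iff_injective _).2 hf
  epi_g := (AddCommGrpCat.epi_iff_surjective _).2 hg

/-- The values of a short exact sequence of functors form short exact sequences. -/
theorem shortExact_app {X : Type u} [Category X] {S : ShortComplex (X ⥤ AddCommGrpCat.{v})}
    (hS : S.ShortExact) (x : X) : Function.Injective (S.f.app x) ∧
      Function.Surjective (S.g.app x) ∧ Function.Exact (S.f.app x) (S.g.app x) := by
  have h := hS.map_of_exact ((evaluation X AddCommGrpCat.{v}).obj x)
  exact ⟨h.ab_injective_f, h.ab_surjective_g, (ShortComplex.ab_exact_iff_function_exact _).1 h.exact⟩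

/-- Homology vanishes in a degree in which all cycles are boundaries. -/
theorem isZero_homology_of_forall_cycle (K : ChainComplex AddCommGrpCat.{v} ℤ) (n : ℤ)
    (h : ∀ c : K.X n, K.d n (n - 1) c = 0 → ∃ b : K.X (n + 1), K.d (n + 1) n b = c) :
    Limits.IsZero (K.homology n) := by
  rw [← K.exactAt_iff_isZero_homology, K.exactAt_iff' (n + 1) n (n - 1) (by simp) (by simp),
    ShortComplex.ab_exact_iff]
  exact h

/-! ### The cube complex as a functor -/

section CubeFunctor

variable {L : Type u} [BooleanAlgebra L] {F G H : L ⥤ AddCommGrpCat.{v}}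

/-- The homomorphism `K_i(L, F) → K_i(L, G)` induced by a natural transformation. -/
def cubeMap (φ : F ⟶ G) (i : ℤ) : CubeGroup F i →+ CubeGroup G i :=
  DirectSum.map fun x : Vertex L i => (φ.app x.1).hom

theorem cubeMap_of (φ : F ⟶ G) {i : ℤ} (x : Vertex L i) (l : F.obj x.1) :
    cubeMap φ i (ofVertex F x l) = ofVertex G x (φ.app x.1 l) := by
  classical
  exact DirectSum.map_of _ _ _

variable [Finite L] {n : ℕ} (e : Fin n ≃ {a : L // IsAtom a})

theorem cubeD_comp_cubeMap (φ : F ⟶ G) (i j : ℤ) :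
    (cubeD G e i j).comp (cubeMap φ i) = (cubeMap φ j).comp (cubeD F e i j) := by
  classical
  let _ := Fintype.ofFinite (Vertex L j)
  refine cubeGroup_hom_ext F fun x l => ?_
  rw [AddMonoidHom.comp_apply, AddMonoidHom.comp_apply, cubeMap_of, cubeD_of, cubeD_of, map_sum]
  refine Finset.sum_congr rfl fun y _ => ?_
  split_ifs with h
  · rw [map_zsmul, cubeMap_of, NatTrans.naturality_apply]
  · rw [map_zero]

/-- The cube complex as a functor of the coefficients. -/
def cubeFunctor : (L ⥤ AddCommGrpCat.{v}) ⥤ ChainComplex AddCommGrpCat.{max u v} ℤ where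
  obj F := cubeComplex F e
  map φ :=
    { f := fun i => AddCommGrpCat.ofHom (cubeMap φ i)
      comm' := fun i j _ => by
        change AddCommGrpCat.ofHom _ ≫ AddCommGrpCat.ofHom _ =
          AddCommGrpCat.ofHom _ ≫ AddCommGrpCat.ofHom _
        rw [← AddCommGrpCat.ofHom_comp, ← AddCommGrpCat.ofHom_comp, cubeD_comp_cubeMap] }
  map_id F := by
    ext i : 2
    exact cubeGroup_hom_ext F fun x l => cubeMap_of _ x l
  map_comp φ ψ := by
    ext i : 2
    refine cubeGroup_hom_ext _ fun x l => ?_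
    change cubeMap _ i _ = cubeMap _ i (cubeMap _ i _)
    rw [cubeMap_of, cubeMap_of, cubeMap_of]
    rfl

instance : (cubeFunctor.{u, v} e).Additive where
  map_add {F G φ ψ} := by
    ext i : 2
    refine cubeGroup_hom_ext F fun x l => ?_
    change cubeMap (φ + ψ) i _ = cubeMap φ i _ + cubeMap ψ i _
    rw [cubeMap_of, cubeMap_of, cubeMap_of, ← map_add]
    rfl

theorem shortExact_cubeFunctor (S : ShortComplex (L ⥤ AddCommGrpCat.{v})) (hS : S.ShortExact) :
    (S.map (cubeFunctor e)).ShortExact := by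
  refine HomologicalComplex.shortExact_of_degreewise_shortExact _ fun i => ?_
  refine shortExact_of_exact ?_ ?_ ?_
  · exact (DirectSum.map_injective _).2 fun x => (shortExact_app hS x.1).1
  · exact (DirectSum.map_surjective _).2 fun x => (shortExact_app hS x.1).2.1
  · exact directSum_map_exact _ _ fun x => (shortExact_app hS x.1).2.2

end CubeFunctor

/-! ### The cube complex of an induced functor -/

section CubeInduced

variable {L : Type u} [BooleanAlgebra L]

theorem sdiff_covBy {a y : L} (ha : IsAtom a) (hay : a ≤ y) : y \ a ⋖ y := by
  have h : a ⊓ (y \ a) ⋖ a := by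
    rw [inf_sdiff_self_right]
    exact bot_covBy_iff.2 ha
  have := h.sup_of_inf_left
  rwa [sup_sdiff_cancel_right hay] at this

theorem covBy_sup {a y : L} (ha : IsAtom a) (hay : ¬ a ≤ y) : y ⋖ y ⊔ a := by
  have h : a ⊓ y ⋖ a := by
    rw [((IsAtom.not_le_iff_disjoint ha).1 hay).eq_bot]
    exact bot_covBy_iff.2 ha
  rw [sup_comm]
  exact h.sup_of_inf_left

theorem flip_sdiff {a y z : L} (hay : a ≤ y) (hyz : y ≤ z) : flip (y \ a) z y = z \ a := by
  refine le_antisymm (sup_le (sdiff_le_sdiff_right hyz) (sdiff_le_sdiff_left hay)) ?_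
  rw [sdiff_le_iff, flip, ← sup_assoc, sup_sdiff_cancel_right hay, sup_sdiff_cancel_right hyz]

section Sign

variable {n : ℕ} (e : Fin n ≃ {a : L // IsAtom a})

open Classical in
/-- The sign of a cover relation, extended by zero to all pairs. -/
def incidence (x y : L) : ℤ := if h : x ⋖ y then coverSign e h else 0

theorem incidence_of_covBy {x y : L} (h : x ⋖ y) : incidence e x y = coverSign e h := dif_pos h

theorem incidence_of_not {x y : L} (h : ¬ x ⋖ y) : incidence e x y = 0 := dif_neg h

theorem incidence_mul_self {x y : L} (h : x ⋖ y) : incidence e x y * incidence e x y = 1 := by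
  rw [incidence_of_covBy e h, coverSign, ← Finset.prod_mul_distrib]
  refine Finset.prod_eq_one fun j _ => ?_
  rw [← mul_pow, neg_mul_neg, one_mul, one_pow]

/-- The elements `y \ a`, `y`, `z \ a`, `z` form a square of the cube, and squares anticommute.
Since every sign is its own inverse, the factors can be rearranged into the form needed for the
contraction. -/
theorem incidence_sdiff {a y z : L} (ha : IsAtom a) (hay : a ≤ y) (h : y ⋖ z) :
    incidence e (y \ a) y * incidence e (y \ a) (z \ a) =
      - (incidence e y z * incidence e (z \ a) z) := by
  have h1 := sdiff_covBy ha hay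
  have hf := flip_sdiff hay h.le
  have h2 := covBy_flip h1 h
  have h3 := flip_covBy h1 h
  have key := coverSign_flip e h1 h
  rw [← incidence_of_covBy, ← incidence_of_covBy, ← incidence_of_covBy, ← incidence_of_covBy,
    hf] at key
  rw [hf] at h3
  have e1 := incidence_mul_self e h1
  have e3 := incidence_mul_self e h3
  -- Multiply the anticommutation relation by the two signs in direction `a`; their squares, which
  -- are `1`, drop out.
  linear_combination (incidence e (y \ a) y * incidence e (z \ a) z) * key -
    (incidence e (y \ a) y * incidence e (y \ a) (z \ a)) * e3 -
    (incidence e y z * incidence e (z \ a) z) * e1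

end Sign

variable {x : L} {A : AddCommGrpCat.{v}}

open Classical in
/-- The inclusion of `A` as the summand of `y` in `K_i(L, induced x A)`; zero if there is none. -/
def cubeOf (x : L) (A : AddCommGrpCat.{v}) (i : ℤ) (y : L) : A →+ CubeGroup (induced x A) i :=
  if h : (rank y : ℤ) = rank (⊤ : L) - i then
    (ofVertex (induced x A) ⟨y, h⟩).comp (inducedOf x y A)
  else 0

theorem cubeOf_apply {i : ℤ} (y : Vertex L i) (b : A) :
    cubeOf x A i y.1 b = ofVertex (induced x A) y (inducedOf x y.1 A b) := by
  rw [cubeOf, dif_pos y.2]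
  rfl

theorem cubeOf_eq_zero {i : ℤ} {y : L} (h : ¬ (rank y : ℤ) = rank (⊤ : L) - i) (b : A) :
    cubeOf x A i y b = 0 := by
  rw [cubeOf, dif_neg h]
  rfl

theorem cubeOf_eq_zero_of_not_le {i : ℤ} {y : L} (h : ¬ x ≤ y) (b : A) :
    cubeOf x A i y b = 0 := by
  by_cases hy : (rank y : ℤ) = rank (⊤ : L) - i
  · rw [cubeOf_apply ⟨y, hy⟩, inducedOf_of_not_le h, map_zero]
  · exact cubeOf_eq_zero hy b

theorem cubeInduced_hom_ext {i : ℤ} {G : Type*} [AddCommGroup G]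
    {f g : CubeGroup (induced x A) i →+ G}
    (h : ∀ (y : L) (b : A), x ≤ y → (rank y : ℤ) = rank (⊤ : L) - i →
      f (cubeOf x A i y b) = g (cubeOf x A i y b)) : f = g := by
  refine cubeGroup_hom_ext _ fun y l => ?_
  by_cases hy : x ≤ y.1
  · have := h y.1 (inducedVal l) hy y.2
    rwa [cubeOf_apply, inducedOf_val] at this
  · rw [eq_zero_of_not_le hy l, map_zero, map_zero, map_zero]

variable [Finite L] {n : ℕ} (e : Fin n ≃ {a : L // IsAtom a})

/-- With all summands parametrized by `A`, the transition maps disappear. The sum may run over all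
of `L`, because `incidence` vanishes off the covers and `cubeOf` off the right rank. Without `x ≤ y`
the left side would vanish, although some cover of `y` could lie above `x`. -/
theorem cubeD_cubeOf [Fintype L] {i j : ℤ} {y : L} (hy : x ≤ y)
    (hi : (rank y : ℤ) = rank (⊤ : L) - i) (b : A) :
    cubeD (induced x A) e i j (cubeOf x A i y b) =
      ∑ z, incidence e y z • cubeOf x A j z b := by
  classical
  let _ := Fintype.ofFinite (Vertex L j)
  rw [cubeOf_apply ⟨y, hi⟩, cubeD_of]
  refine Fintype.sum_of_injective Subtype.val Subtype.val_injective _ _ (fun z hz => ?_)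
    fun z => ?_
  · rw [cubeOf_eq_zero, smul_zero]
    exact fun h => hz ⟨⟨z, h⟩, rfl⟩
  · split_ifs with h
    · rw [incidence_of_covBy e h, cubeOf_apply, inducedOf_map hy]
    · rw [incidence_of_not e h, zero_smul]

open Classical in
/-- The contraction of the cube complex of an induced functor that deletes the atom `a`. -/
def cubeContraction (x a : L) (A : AddCommGrpCat.{v}) (i j : ℤ) :
    CubeGroup (induced x A) i →+ CubeGroup (induced x A) j :=
  DirectSum.toAddMonoid fun y : Vertex L i =>
    (if a ≤ y.1 then incidence e (y.1 \ a) y.1 else 0) •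
      (cubeOf x A j (y.1 \ a)).comp inducedVal

-- This needs no condition on `y`: if `y` has the wrong rank or is not above `x`, the right side
-- vanishes too, because deleting an atom of `y` lowers the rank by exactly one and never produces
-- an element above `x`.
open Classical in
theorem cubeContraction_cubeOf {a : L} (ha : IsAtom a) {i j : ℤ} (hij : i + 1 = j) (y : L) (b : A) :
    cubeContraction e x a A i j (cubeOf x A i y b) =
      (if a ≤ y then incidence e (y \ a) y else 0) • cubeOf x A j (y \ a) b := by
  by_cases hx : x ≤ y
  · by_cases hi : (rank y : ℤ) = rank (⊤ : L) - i
    · rw [cubeOf_apply ⟨y, hi⟩, ofVertex, cubeContraction, DirectSum.toAddMonoid_of,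
        AddMonoidHom.smul_apply, AddMonoidHom.comp_apply, inducedVal_of hx]
    · rw [cubeOf_eq_zero hi, map_zero]
      split_ifs with h
      · rw [cubeOf_eq_zero, smul_zero]
        have := rank_covBy (sdiff_covBy ha h)
        lia
      · rw [zero_smul]
  · rw [cubeOf_eq_zero_of_not_le hx, map_zero,
      cubeOf_eq_zero_of_not_le fun h => hx (h.trans sdiff_le), smul_zero]

/-- Since `a` is not below `x`, the elements above `x` come in pairs `y`, `y ⊔ a`. The differential
contains a signed identity of `A` within each pair, and the contraction inverts it; all other terms
cancel by anticommutation of squares. -/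
theorem cubeContraction_spec {a : L} (ha : IsAtom a) (hax : ¬ a ≤ x) (i : ℤ) :
    (cubeD (induced x A) e (i + 1) i).comp (cubeContraction e x a A i (i + 1)) +
      (cubeContraction e x a A (i - 1) i).comp (cubeD (induced x A) e i (i - 1)) =
        AddMonoidHom.id _ := by
  classical
  let _ := Fintype.ofFinite L
  refine cubeInduced_hom_ext fun y b hy hi => ?_
  rw [AddMonoidHom.add_apply, AddMonoidHom.comp_apply, AddMonoidHom.comp_apply,
    AddMonoidHom.id_apply, cubeContraction_cubeOf e ha rfl, cubeD_cubeOf e hy hi, map_sum]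
  have hc (z : L) : cubeContraction e x a A (i - 1) i
      (incidence e y z • cubeOf x A (i - 1) z b) =
        (incidence e y z * if a ≤ z then incidence e (z \ a) z else 0) •
          cubeOf x A i (z \ a) b := by
    rw [map_zsmul, cubeContraction_cubeOf e ha (by ring), mul_smul]
  simp only [hc]
  by_cases hay : a ≤ y
  · have hcov := sdiff_covBy ha hay
    have hxa : x ≤ y \ a := le_sdiff.2 ⟨hy, ((IsAtom.not_le_iff_disjoint ha).1 hax).symm⟩
    have hr := rank_covBy hcov
    -- Deleting `a` and applying the differential returns `y` with coefficient a squared sign, that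
    -- is `1`. What remains is that the other covers of `y \ a` cancel against the terms in which
    -- the differential comes first.
    rw [if_pos hay, map_zsmul, cubeD_cubeOf e hxa (by lia), Finset.smul_sum,
      ← Finset.add_sum_erase _ _ (Finset.mem_univ y), ← mul_smul, incidence_mul_self e hcov,
      one_smul, add_assoc, add_eq_left, ← eq_neg_iff_add_eq_zero, ← Finset.sum_neg_distrib]
    rw [← Finset.sum_filter_of_ne (s := Finset.univ.erase y) (p := fun z => y \ a ⋖ z),
      ← Finset.sum_filter_of_ne (s := Finset.univ) (p := fun z => y ⋖ z)]
    · have h1 {z : L} (hz : y \ a ⋖ z) (hne : z ≠ y) : ¬ a ≤ z := by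
        intro haz
        have : y ≤ z := by
          rw [← sdiff_sup_cancel hay]
          exact sup_le hz.le haz
        exact hne ((hz.eq_or_eq hcov.le this).resolve_left hcov.ne').symm
      have h2 {z : L} (hz : y \ a ⋖ z) (hne : z ≠ y) : (z ⊔ a) \ a = z := by
        rw [sup_sdiff_right_self]
        exact ((IsAtom.not_le_iff_disjoint ha).1 (h1 hz hne)).symm.sdiff_eq_left
      have h3 {z : L} (hz : y \ a ⋖ z) (hne : z ≠ y) : y ⋖ z ⊔ a := by
        have hinf : z ⊓ y = y \ a :=
          le_antisymm (le_sdiff.2 ⟨inf_le_right, ((IsAtom.not_le_iff_disjoint ha).1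
            (h1 hz hne)).symm.mono_left inf_le_left⟩) (le_inf hz.le sdiff_le)
        have hsup : z ⊔ a = z ⊔ y := by
          conv_rhs => rw [← sdiff_sup_cancel hay, ← sup_assoc, sup_eq_left.2 hz.le]
        rw [hsup]
        exact CovBy.sup_of_inf_left (hinf ▸ hz)
      -- Adding `a` matches the covers of `y \ a` other than `y` with the covers of `y`; deleting
      -- `a` is the inverse.
      refine Finset.sum_nbij' (· ⊔ a) (· \ a) (fun z hz => ?_) (fun z hz => ?_) (fun z hz => ?_)
        (fun z hz => ?_) (fun z hz => ?_)
      all_goals simp only [Finset.mem_filter, Finset.mem_erase, Finset.mem_univ, true_and,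
        and_true] at hz ⊢
      · exact h3 hz.2 hz.1
      · refine ⟨fun h => ha.1 ?_, flip_sdiff hay hz.le ▸ covBy_flip hcov hz⟩
        exact (disjoint_sdiff_self_right (x := a) (y := z)).eq_bot_of_le (h ▸ hay)
      · exact h2 hz.2 hz.1
      · exact sdiff_sup_cancel (hay.trans hz.le)
      · have := incidence_sdiff e ha hay (h3 hz.2 hz.1)
        rw [h2 hz.2 hz.1] at this
        rw [if_pos le_sup_right, h2 hz.2 hz.1, ← mul_smul, this, neg_smul]
    · intro z _ hz
      by_contra h
      exact hz (by rw [incidence_of_not e h, zero_mul, zero_smul, neg_zero])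
    · intro z _ hz
      by_contra h
      exact hz (by rw [incidence_of_not e h, zero_smul, smul_zero])
  · have hcov := covBy_sup ha hay
    -- The contraction kills the summand of `y`, and among the covers of `y` only `y ⊔ a` contains
    -- `a`.
    rw [if_neg hay, zero_smul, map_zero, zero_add, Finset.sum_eq_single (y ⊔ a)]
    · have : (y ⊔ a) \ a = y := by
        rw [sup_sdiff_right_self]
        exact (((IsAtom.not_le_iff_disjoint ha).1 hay).symm).sdiff_eq_left
      rw [if_pos le_sup_right, this, incidence_mul_self e hcov, one_smul]
    · intro z _ hz
      by_cases hyz : y ⋖ z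
      · rw [if_neg, mul_zero, zero_smul]
        intro haz
        exact hz ((hyz.eq_or_eq le_sup_left (sup_le hyz.le haz)).resolve_left hcov.ne').symm
      · rw [incidence_of_not e hyz, zero_mul, zero_smul]
    · exact fun h => absurd (Finset.mem_univ _) h

theorem exists_isAtom_not_le (hx : x ≠ ⊤) : ∃ a : L, IsAtom a ∧ ¬ a ≤ x := by
  obtain ⟨a, ha, hax⟩ := (eq_bot_or_exists_atom_le xᶜ).resolve_left fun h => hx (compl_eq_bot.1 h)
  exact ⟨a, ha, (IsAtom.not_le_iff_disjoint ha).2 (le_compl_iff_disjoint_right.1 hax)⟩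

theorem isZero_cubeComplex_induced_homology (x : L) (A : AddCommGrpCat.{v}) {i : ℤ} (hi : 0 < i) :
    Limits.IsZero ((cubeComplex (induced x A) e).homology i) := by
  refine isZero_homology_of_forall_cycle _ _ fun c hc => ?_
  rcases eq_or_ne x ⊤ with rfl | hx
  · have h : AddMonoidHom.id (CubeGroup (induced (⊤ : L) A) i) = 0 := by
      refine cubeInduced_hom_ext fun y b hy hr => ?_
      rw [top_le_iff.1 hy] at hr
      lia
    exact ⟨0, (map_zero _).trans (DFunLike.congr_fun h c).symm⟩
  · obtain ⟨a, ha, hax⟩ := exists_isAtom_not_le hx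
    refine ⟨cubeContraction e x a A i (i + 1) c, ?_⟩
    have h : cubeD (induced x A) e (i + 1) i (cubeContraction e x a A i (i + 1) c) +
        cubeContraction e x a A (i - 1) i (cubeD (induced x A) e i (i - 1) c) = c :=
      DFunLike.congr_fun (cubeContraction_spec (A := A) e ha hax i) c
    rwa [show cubeD (induced x A) e i (i - 1) c = 0 from hc, map_zero, add_zero] at h

end CubeInduced

/-! ### Signs of faces and inserted minima -/

section Chains

variable {X : Type u} [PartialOrder X]

theorem toChain_self (F : X ⥤ AddCommGrpCat.{v}) {n : ℤ} (s : NChain X n) (l : F.obj s.min) :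
    toChain F n s.min s.1 l = ofChain F s l := by
  rw [toChain_apply F s.2 fun b hb => s.min_isLeast.2 hb]
  change ofChain F s (F.map (𝟙 s.min) l) = ofChain F s l
  rw [F.map_id]
  rfl

theorem inducedOf_val_map {x y : X} {A : AddCommGrpCat.{v}} (h : x ≤ y) (l : (induced x A).obj y) :
    (induced x A).map (homOfLE h) (inducedOf x x A (inducedVal l)) = l := by
  rw [inducedOf_map le_rfl, inducedOf_val]

theorem faceSign_of_le {s : Finset X} {a : X} (h : ∀ b ∈ s, a ≤ b) : faceSign s a = 1 := by
  classical
  rw [faceSign, Finset.filter_false_of_mem fun b hb => (h b hb).not_gt]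
  rfl

theorem faceSign_insert [DecidableEq X] {t : Finset X} {x a : X} (hxt : x ∉ t) (hxa : x < a) :
    faceSign (insert x t) a = - faceSign t a := by
  classical
  have h1 : (insert x t).filter (· < a) = insert x (t.filter (· < a)) := by
    rw [Finset.filter_insert, if_pos hxa]
  have h2 : ((insert x t).filter (· < a)).card = (t.filter (· < a)).card + 1 := by
    rw [h1, Finset.card_insert_of_notMem fun h => hxt (Finset.mem_of_mem_filter _ h)]
  rw [faceSign, faceSign, h2, pow_succ, mul_neg_one]

end Chains

/-! ### Chains containing the greatest element -/

section RelativeChains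

variable {X : Type u} [PartialOrder X] [OrderTop X]

variable (X) in
/-- The `n`-chains of `X` that contain the greatest element. -/
abbrev TopChain (n : ℤ) : Type u := {s : NChain X n // ⊤ ∈ s.1}

variable (F : X ⥤ AddCommGrpCat.{v})

/-- The direct sum of the groups `F (min σ)` over the `n`-chains `σ` that contain `⊤`. -/
abbrev TopChainGroup (n : ℤ) : Type max u v := DirectSum (TopChain X n) fun s => F.obj s.1.min

open Classical in
/-- The inclusion of the summand of `s`. -/
def ofTopChain {n : ℤ} (s : TopChain X n) : F.obj s.1.min →+ TopChainGroup F n :=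
  DirectSum.of (fun s : TopChain X n => F.obj s.1.min) s

variable {F} in
theorem topChainGroup_hom_ext {n : ℤ} {G : Type*} [AddCommGroup G] {f g : TopChainGroup F n →+ G}
    (h : ∀ (s : TopChain X n) (l : F.obj s.1.min), f (ofTopChain F s l) = g (ofTopChain F s l)) :
    f = g := by
  classical
  exact DirectSum.addHom_ext h

/-- The inclusion of the summands of the chains that contain `⊤`. -/
def topIncl (n : ℤ) : TopChainGroup F n →+ ChainGroup F n := by
  classical
  exact DirectSum.toAddMonoid fun s : TopChain X n => ofChain F s.1

open Classical in
/-- The projection onto the summands of the chains that contain `⊤`. -/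
def topProj (n : ℤ) : ChainGroup F n →+ TopChainGroup F n :=
  descChain F fun s : NChain X n => if h : ⊤ ∈ s.1 then ofTopChain F ⟨s, h⟩ else 0

theorem topIncl_of {n : ℤ} (s : TopChain X n) (l : F.obj s.1.min) :
    topIncl F n (ofTopChain F s l) = ofChain F s.1 l := by
  classical
  exact DirectSum.toAddMonoid_of _ _ _

theorem topProj_of {n : ℤ} (s : TopChain X n) (l : F.obj s.1.min) :
    topProj F n (ofChain F s.1 l) = ofTopChain F s l := by
  rw [topProj, descChain_of, dif_pos s.2]

theorem topProj_of_notMem {n : ℤ} {s : NChain X n} (h : ⊤ ∉ s.1) (l : F.obj s.min) :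
    topProj F n (ofChain F s l) = 0 := by
  rw [topProj, descChain_of, dif_neg h]
  rfl

theorem topProj_topIncl {n : ℤ} (c : TopChainGroup F n) : topProj F n (topIncl F n c) = c := by
  refine DFunLike.congr_fun (f := (topProj F n).comp (topIncl F n)) (g := AddMonoidHom.id _) ?_ c
  refine topChainGroup_hom_ext fun s l => ?_
  rw [AddMonoidHom.comp_apply, topIncl_of, topProj_of]
  rfl

/-- The homomorphism `F x → C_n(X; F)` of `toChain`, composed with the projection `topProj`. -/
def toTopChain (n : ℤ) (x : X) (t : Finset X) : F.obj x →+ TopChainGroup F n :=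
  (topProj F n).comp (toChain F n x t)

theorem toTopChain_self {n : ℤ} (s : TopChain X n) (l : F.obj s.1.min) :
    toTopChain F n s.1.min s.1.1 l = ofTopChain F s l := by
  rw [toTopChain, AddMonoidHom.comp_apply, toChain_self, topProj_of]

theorem toTopChain_apply {n : ℤ} {x : X} {t : Finset X} (h : IsNChain n t) (hx : ∀ b ∈ t, x ≤ b)
    (ht : ⊤ ∈ t) (l : F.obj x) : toTopChain F n x t l =
      ofTopChain F ⟨⟨t, h⟩, ht⟩ (F.map (homOfLE (hx _ (NChain.min_isLeast ⟨t, h⟩).1)) l) := by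
  rw [toTopChain, AddMonoidHom.comp_apply, toChain_apply F h hx,
    ← topProj_of F ⟨⟨t, h⟩, ht⟩]

theorem toTopChain_of_not {n : ℤ} {x : X} {t : Finset X}
    (h : ¬ (IsNChain n t ∧ ∀ b ∈ t, x ≤ b)) (l : F.obj x) : toTopChain F n x t l = 0 := by
  rw [toTopChain, AddMonoidHom.comp_apply, toChain_of_not F h, AddMonoidHom.zero_apply, map_zero]

theorem toTopChain_of_notMem {n : ℤ} {x : X} {t : Finset X} (h : ⊤ ∉ t) (l : F.obj x) :
    toTopChain F n x t l = 0 := by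
  by_cases ht : IsNChain n t ∧ ∀ b ∈ t, x ≤ b
  · rw [toTopChain, AddMonoidHom.comp_apply, toChain_apply F ht.1 ht.2, topProj_of_notMem]
    exact h
  · exact toTopChain_of_not F ht l

/-- The differential on chains that contain `⊤`. -/
def topD (n m : ℤ) : TopChainGroup F n →+ TopChainGroup F m :=
  ((topProj F m).comp (chainD F n m)).comp (topIncl F n)

/-- The faces of a chain without `⊤` are again without `⊤`, so the kernel of the projection is
stable under the differential. -/
theorem topD_comp_topProj (n m : ℤ) :
    (topD F n m).comp (topProj F n) = (topProj F m).comp (chainD F n m) := by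
  classical
  refine chainGroup_hom_ext F fun s l => ?_
  by_cases hs : ⊤ ∈ s.1
  · rw [AddMonoidHom.comp_apply, topProj_of F ⟨s, hs⟩, topD, AddMonoidHom.comp_apply, topIncl_of]
  · rw [AddMonoidHom.comp_apply, topProj_of_notMem F hs, map_zero, AddMonoidHom.comp_apply,
      chainD_of, map_sum]
    refine (Finset.sum_eq_zero fun a _ => ?_).symm
    rw [map_zsmul]
    have := toTopChain_of_notMem F (n := m) (x := s.min) (t := s.1.erase a)
      (fun h => hs (Finset.mem_of_mem_erase h)) l
    rw [toTopChain, AddMonoidHom.comp_apply] at this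
    rw [this, smul_zero]

theorem topD_topProj {n m : ℤ} (c : ChainGroup F n) :
    topD F n m (topProj F n c) = topProj F m (chainD F n m c) :=
  DFunLike.congr_fun (topD_comp_topProj F n m) c

theorem topD_toTopChain [DecidableEq X] {n m : ℤ} {x : X} {t : Finset X}
    (hc : IsChain (· ≤ ·) (t : Set X)) (hn : (t.card : ℤ) = n + 1) (hx : ∀ b ∈ t, x ≤ b)
    (l : F.obj x) :
    topD F n m (toTopChain F n x t l) =
      ∑ a ∈ t, faceSign t a • toTopChain F m x (t.erase a) l := by
  rw [toTopChain, AddMonoidHom.comp_apply, topD_topProj, chainD_toChain F hc hn hx, map_sum]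
  refine Finset.sum_congr rfl fun a _ => ?_
  rw [map_zsmul]
  rfl

theorem topD_shape {i j : ℤ} (hij : ¬ j + 1 = i) : topD F i j = 0 := by
  refine topChainGroup_hom_ext fun s l => ?_
  rw [topD, chainD_shape F hij]
  exact map_zero (topProj F j)

theorem topD_comp_topD {i j k : ℤ} (hij : j + 1 = i) :
    (topD F j k).comp (topD F i j) = 0 := by
  refine topChainGroup_hom_ext fun s l => ?_
  rw [AddMonoidHom.comp_apply, ← topProj_of, topD_topProj, topD_topProj]
  have := DFunLike.congr_fun (chainD_comp_chainD F (k := k) hij) (ofChain F s.1 l)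
  rw [AddMonoidHom.comp_apply] at this
  rw [this]
  exact map_zero (topProj F k)

/-- The chain complex of the chains that contain `⊤`. -/
def topComplex : ChainComplex AddCommGrpCat.{max u v} ℤ where
  X n := AddCommGrpCat.of (TopChainGroup F n)
  d n m := AddCommGrpCat.ofHom (topD F n m)
  shape i j hij := by
    rw [topD_shape F (by simpa using hij)]
    rfl
  d_comp_d' i j k hij _ := by
    rw [← AddCommGrpCat.ofHom_comp, topD_comp_topD F (by simpa using hij)]
    rfl

/-- The projection of chain complexes onto the chains that contain `⊤`. -/
def topProjHom : chainComplex F ⟶ topComplex F where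
  f n := AddCommGrpCat.ofHom (topProj F n)
  comm' i j _ := by
    change AddCommGrpCat.ofHom _ ≫ AddCommGrpCat.ofHom _ =
      AddCommGrpCat.ofHom _ ≫ AddCommGrpCat.ofHom _
    rw [← AddCommGrpCat.ofHom_comp, ← AddCommGrpCat.ofHom_comp, topD_comp_topProj]

theorem topProj_inclHom (n : ℤ) :
    (topProj F n).comp (inclHom F ({⊤}ᶜ : Set X) n) = 0 := by
  refine chainGroup_hom_ext _ fun s l => ?_
  rw [AddMonoidHom.comp_apply, inclHom_of]
  refine toTopChain_of_notMem F (fun h => ?_) l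
  obtain ⟨b, -, hb⟩ := Finset.mem_map.1 h
  exact b.2 hb

/-- Modulo the chains of `X - {⊤}`, every element agrees with its part supported on chains through
`⊤`. This can be checked on generators in the quotient group. -/
theorem exists_inclHom_eq {n : ℤ} (c : ChainGroup F n) (hc : topProj F n c = 0) :
    ∃ c', inclHom F ({⊤}ᶜ : Set X) n c' = c := by
  classical
  let q := QuotientAddGroup.mk' (inclHom F ({⊤}ᶜ : Set X) n).range
  have key : q = q.comp ((topIncl F n).comp (topProj F n)) := by
    refine chainGroup_hom_ext F fun s l => ?_
    rw [AddMonoidHom.comp_apply, AddMonoidHom.comp_apply]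
    by_cases hs : ⊤ ∈ s.1
    · rw [topProj_of F ⟨s, hs⟩, topIncl_of]
    · rw [topProj_of_notMem F hs, map_zero, map_zero]
      have hA : ∀ b ∈ s.1, b ∈ ({⊤}ᶜ : Set X) := fun b hb h => hs (h ▸ hb)
      refine (QuotientAddGroup.eq_zero_iff _).2 ⟨toChain (restrict F {⊤}ᶜ) n
        ⟨s.min, hA _ s.min_isLeast.1⟩ (s.1.subtype (· ∈ ({⊤}ᶜ : Set X))) l, ?_⟩
      refine (inclHom_toChain F ({⊤}ᶜ : Set X) (x := ⟨s.min, hA _ s.min_isLeast.1⟩)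
        (t := s.1.subtype (· ∈ ({⊤}ᶜ : Set X))) (fun b hb => ?_) l).trans ?_
      · exact s.min_isLeast.2 (Finset.mem_subtype.1 hb)
      rw [Finset.subtype_map_of_mem hA]
      exact toChain_self F s l
  have h := DFunLike.congr_fun key c
  rw [AddMonoidHom.comp_apply, AddMonoidHom.comp_apply, hc, map_zero, map_zero] at h
  exact (QuotientAddGroup.eq_zero_iff c).1 h

/-- The complex of the chains that contain `⊤` is the complex of `X` relative to `X - {⊤}`. -/
def relativeComplexIso : relativeComplex F ({⊤}ᶜ : Set X) ≅ topComplex F := by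
  have w : incl F ({⊤}ᶜ : Set X) ≫ topProjHom F = 0 := by
    ext n : 2
    exact topProj_inclHom F n
  have hepi (n : ℤ) : Epi ((topProjHom F).f n) :=
    (AddCommGrpCat.epi_iff_surjective _).2 fun c => ⟨topIncl F n c, topProj_topIncl F c⟩
  have hex : (ShortComplex.mk _ _ w).Exact := by
    refine HomologicalComplex.exact_of_degreewise_exact _ fun n => ?_
    rw [ShortComplex.ab_exact_iff]
    exact fun c hc => exists_inclHom_eq F c hc
  have : Epi (ShortComplex.mk _ _ w).g := HomologicalComplex.epi_of_epi_f (topProjHom F) hepi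
  exact (Limits.cokernelIsCokernel (incl F ({⊤}ᶜ : Set X))).coconePointUniqueUpToIso
    hex.gIsCokernel

end RelativeChains

/-! ### Exactness of the complex of chains containing `⊤` -/

section TopFunctor

variable {X : Type u} [PartialOrder X] [OrderTop X] {F G : X ⥤ AddCommGrpCat.{v}}

/-- The homomorphism of chain groups that is induced by a natural transformation. -/
def topMap (φ : F ⟶ G) (n : ℤ) : TopChainGroup F n →+ TopChainGroup G n :=
  DirectSum.map fun s : TopChain X n => (φ.app s.1.min).hom

theorem topMap_of (φ : F ⟶ G) {n : ℤ} (s : TopChain X n) (l : F.obj s.1.min) :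
    topMap φ n (ofTopChain F s l) = ofTopChain G s (φ.app s.1.min l) := by
  classical
  exact DirectSum.map_of _ _ _

theorem topMap_toTopChain (φ : F ⟶ G) {n : ℤ} (x : X) (t : Finset X) (l : F.obj x) :
    topMap φ n (toTopChain F n x t l) = toTopChain G n x t (φ.app x l) := by
  by_cases h : IsNChain n t ∧ ∀ b ∈ t, x ≤ b
  · by_cases ht : ⊤ ∈ t
    · rw [toTopChain_apply F h.1 h.2 ht, toTopChain_apply G h.1 h.2 ht, topMap_of,
        NatTrans.naturality_apply]
    · rw [toTopChain_of_notMem F ht, toTopChain_of_notMem G ht, map_zero]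
  · rw [toTopChain_of_not F h, toTopChain_of_not G h, map_zero]

theorem topD_ofTopChain [DecidableEq X] {n m : ℤ} (s : TopChain X n) (l : F.obj s.1.min) :
    topD F n m (ofTopChain F s l) =
      ∑ a ∈ s.1.1, faceSign s.1.1 a • toTopChain F m s.1.min (s.1.1.erase a) l := by
  rw [← toTopChain_self, topD_toTopChain F s.1.2.isChain s.1.2.card_eq
    fun b hb => s.1.min_isLeast.2 hb]

theorem topD_comp_topMap (φ : F ⟶ G) (n m : ℤ) :
    (topD G n m).comp (topMap φ n) = (topMap φ m).comp (topD F n m) := by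
  classical
  refine topChainGroup_hom_ext fun s l => ?_
  rw [AddMonoidHom.comp_apply, AddMonoidHom.comp_apply, topMap_of, topD_ofTopChain,
    topD_ofTopChain, map_sum]
  refine Finset.sum_congr rfl fun a _ => ?_
  rw [map_zsmul, topMap_toTopChain]

variable (X) in
/-- The complex of the chains that contain `⊤` as a functor of the coefficients. -/
def topFunctor : (X ⥤ AddCommGrpCat.{v}) ⥤ ChainComplex AddCommGrpCat.{max u v} ℤ where
  obj F := topComplex F
  map φ :=
    { f := fun i => AddCommGrpCat.ofHom (topMap φ i)
      comm' := fun i j _ => by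
        change AddCommGrpCat.ofHom _ ≫ AddCommGrpCat.ofHom _ =
          AddCommGrpCat.ofHom _ ≫ AddCommGrpCat.ofHom _
        rw [← AddCommGrpCat.ofHom_comp, ← AddCommGrpCat.ofHom_comp, topD_comp_topMap] }
  map_id F := by
    ext i : 2
    exact topChainGroup_hom_ext fun x l => topMap_of _ x l
  map_comp φ ψ := by
    ext i : 2
    refine topChainGroup_hom_ext fun x l => ?_
    change topMap (φ ≫ ψ) i _ = topMap ψ i (topMap φ i _)
    rw [topMap_of, topMap_of, topMap_of]
    rfl

instance : (topFunctor.{u, v} X).Additive where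
  map_add {F G φ ψ} := by
    ext i : 2
    refine topChainGroup_hom_ext fun x l => ?_
    change topMap (φ + ψ) i _ = topMap φ i _ + topMap ψ i _
    rw [topMap_of, topMap_of, topMap_of, ← map_add]
    rfl

theorem shortExact_topFunctor (S : ShortComplex (X ⥤ AddCommGrpCat.{v})) (hS : S.ShortExact) :
    (S.map (topFunctor X)).ShortExact := by
  refine HomologicalComplex.shortExact_of_degreewise_shortExact _ fun i => ?_
  refine shortExact_of_exact ?_ ?_ ?_
  · exact (DirectSum.map_injective _).2 fun x => (shortExact_app hS x.1.min).1
  · exact (DirectSum.map_surjective _).2 fun x => (shortExact_app hS x.1.min).2.1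
  · exact directSum_map_exact _ _ fun x => (shortExact_app hS x.1.min).2.2

end TopFunctor

/-! ### The contraction for induced coefficients -/

section TopInduced

variable {X : Type u} [PartialOrder X] [OrderTop X] {x : X} {A : AddCommGrpCat.{v}}

/-- Only chains lying above `x` carry a nonzero group, and there each coefficient comes from the
value at `x`. Using `x` as the common source avoids tracking how minima change under faces and
insertion. -/
theorem topInduced_hom_ext {n : ℤ} {G : Type*} [AddCommGroup G]
    {f g : TopChainGroup (induced x A) n →+ G}
    (h : ∀ (t : Finset X) (l : (induced x A).obj x), IsNChain n t → (∀ b ∈ t, x ≤ b) → ⊤ ∈ t →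
      f (toTopChain (induced x A) n x t l) = g (toTopChain (induced x A) n x t l)) : f = g := by
  refine topChainGroup_hom_ext fun s l => ?_
  by_cases hx : x ≤ s.1.min
  · have hb : ∀ b ∈ s.1.1, x ≤ b := fun b hb => hx.trans (s.1.min_isLeast.2 hb)
    have := h s.1.1 (inducedOf x x A (inducedVal l)) s.1.2 hb s.2
    rw [toTopChain_apply _ s.1.2 hb s.2] at this
    change f (ofTopChain _ s ((induced x A).map (homOfLE hx) _)) =
      g (ofTopChain _ s ((induced x A).map (homOfLE hx) _)) at this
    rwa [inducedOf_val_map] at this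
  · rw [eq_zero_of_not_le hx l, map_zero, map_zero, map_zero]

open Classical in
/-- The contraction of the complex of chains that contain `⊤`, for an induced functor, that
inserts `x` into chains. -/
def topContraction (x : X) (A : AddCommGrpCat.{v}) (n m : ℤ) :
    TopChainGroup (induced x A) n →+ TopChainGroup (induced x A) m :=
  DirectSum.toAddMonoid fun s : TopChain X n =>
    (toTopChain (induced x A) m x (insert x s.1.1)).comp ((inducedOf x x A).comp inducedVal)

open Classical in
theorem topContraction_of {n m : ℤ} (s : TopChain X n) (l : (induced x A).obj s.1.min) :
    topContraction x A n m (ofTopChain (induced x A) s l) =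
      toTopChain (induced x A) m x (insert x s.1.1) (inducedOf x x A (inducedVal l)) :=
  DirectSum.toAddMonoid_of _ _ _

/-- The condition `x ≠ ⊤` matters when `⊤` is not in `t`: inserting `x` then cannot restore `⊤`, so
both sides vanish. -/
theorem topContraction_toTopChain [DecidableEq X] (hx : x ≠ ⊤) {n m : ℤ} {t : Finset X}
    (hc : IsChain (· ≤ ·) (t : Set X)) (hn : (t.card : ℤ) = n + 1) (hxt : ∀ b ∈ t, x ≤ b)
    (l : (induced x A).obj x) :
    topContraction x A n m (toTopChain (induced x A) n x t l) =
      toTopChain (induced x A) m x (insert x t) l := by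
  by_cases ht : ⊤ ∈ t
  · rw [toTopChain_apply _ ⟨⟨_, ht⟩, hc, hn⟩ hxt ht, topContraction_of, inducedVal_map,
      inducedOf_val]
    congr!
  · rw [toTopChain_of_notMem _ ht, toTopChain_of_notMem, map_zero]
    rw [Finset.mem_insert]
    exact fun h => h.elim (fun h => hx h.symm) ht

/-- This is the usual cone contraction with apex `x`: all relevant chains lie above `x`, and since
`x ≠ ⊤` inserting it respects the quotient by the chains without `⊤`. -/
theorem topContraction_spec (hx : x ≠ ⊤) (n : ℤ) :
    (topD (induced x A) (n + 1) n).comp (topContraction x A n (n + 1)) +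
      (topContraction x A (n - 1) n).comp (topD (induced x A) n (n - 1)) =
        AddMonoidHom.id _ := by
  classical
  refine topInduced_hom_ext fun t l ht hxt htop => ?_
  have hkd : topContraction x A (n - 1) n (topD (induced x A) n (n - 1)
      (toTopChain (induced x A) n x t l)) =
      ∑ a ∈ t, faceSign t a • toTopChain (induced x A) n x (insert x (t.erase a)) l := by
    rw [topD_toTopChain _ ht.isChain ht.card_eq hxt, map_sum]
    refine Finset.sum_congr rfl fun a ha => ?_
    have h1 := Finset.card_erase_add_one ha
    have h2 := ht.card_eq
    rw [map_zsmul, topContraction_toTopChain hx (ht.isChain.mono (by simp)) (by lia)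
      fun b hb => hxt b (Finset.mem_of_mem_erase hb)]
  rw [AddMonoidHom.add_apply, AddMonoidHom.comp_apply, AddMonoidHom.comp_apply,
    AddMonoidHom.id_apply, topContraction_toTopChain hx ht.isChain ht.card_eq hxt, hkd]
  by_cases hmem : x ∈ t
  -- If `x` is already in `t`, insertion yields a set of the wrong cardinality, which counts as `0`
  -- by convention. In the sum over faces only the removal of `x`, followed by its reinsertion,
  -- survives.
  · rw [Finset.insert_eq_of_mem hmem, toTopChain_of_not, map_zero, zero_add,
      Finset.sum_eq_single x]
    · rw [faceSign_of_le hxt, one_smul, Finset.insert_erase hmem]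
    · intro a ha hax
      rw [Finset.insert_eq_of_mem (Finset.mem_erase.2 ⟨hax.symm, hmem⟩), toTopChain_of_not,
        smul_zero]
      intro h
      have h1 := Finset.card_erase_add_one ha
      have h2 := ht.card_eq
      have h3 := h.1.card_eq
      lia
    · exact fun h => absurd hmem h
    · intro h
      have h2 := ht.card_eq
      have h3 := h.1.card_eq
      lia
  · have hle : ∀ b ∈ insert x t, x ≤ b := by
      intro b hb
      rcases Finset.mem_insert.1 hb with rfl | hb
      · exact le_rfl
      · exact hxt b hb
    have hchain : IsChain (· ≤ ·) ((insert x t : Finset X) : Set X) := by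
      rw [Finset.coe_insert]
      exact ht.isChain.insert fun b hb _ => Or.inl (hxt b hb)
    have hcard : ((insert x t).card : ℤ) = n + 1 + 1 := by
      rw [Finset.card_insert_of_notMem hmem, Nat.cast_add, ht.card_eq]
      rfl
    -- Removing the new minimum `x` gives back `t` with sign `1`. Every other vertex has moved up
    -- one position, so its sign is reversed and the remaining faces cancel.
    rw [topD_toTopChain _ hchain hcard hle, Finset.sum_insert hmem, faceSign_of_le hle, one_smul,
      Finset.erase_insert hmem, add_assoc, add_eq_left, ← Finset.sum_add_distrib]
    refine Finset.sum_eq_zero fun a ha => ?_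
    have hne : x ≠ a := fun h => hmem (h ▸ ha)
    rw [faceSign_insert hmem (lt_of_le_of_ne (hxt a ha) hne), Finset.erase_insert_of_ne hne,
      neg_smul, neg_add_cancel]

theorem isZero_topComplex_induced_homology (x : X) (A : AddCommGrpCat.{v}) {n : ℤ} (hn : 0 < n) :
    Limits.IsZero ((topComplex (induced x A)).homology n) := by
  refine isZero_homology_of_forall_cycle _ _ fun c hc => ?_
  rcases eq_or_ne x ⊤ with rfl | hx
  · have h : AddMonoidHom.id (TopChainGroup (induced (⊤ : X) A) n) = 0 := by
      refine topInduced_hom_ext fun t l ht hxt _ => ?_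
      have hcard : t.card ≤ 1 := Finset.card_le_one.2 fun a ha b hb =>
        (top_le_iff.1 (hxt a ha)).trans (top_le_iff.1 (hxt b hb)).symm
      have := ht.card_eq
      lia
    exact ⟨0, (map_zero _).trans (DFunLike.congr_fun h c).symm⟩
  · refine ⟨topContraction x A n (n + 1) c, ?_⟩
    have h : topD (induced x A) (n + 1) n (topContraction x A n (n + 1) c) +
        topContraction x A (n - 1) n (topD (induced x A) n (n - 1) c) = c :=
      DFunLike.congr_fun (topContraction_spec (A := A) hx n) c
    rwa [show topD (induced x A) n (n - 1) c = 0 from hc, map_zero, add_zero] at h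

end TopInduced

/-! ### Homology in degree zero -/

section DegreeZero

/-- The map from the zeroth chain group to homology, if all chains of degree zero are cycles. -/
def zeroClass (K : ChainComplex AddCommGrpCat.{v} ℤ) (h : K.d 0 (-1) = 0) :
    K.X 0 ⟶ K.homology 0 :=
  K.liftCycles (𝟙 _) (-1) (by simp) (by rw [h, Limits.comp_zero]) ≫ K.homologyπ 0

theorem zeroClass_surjective (K : ChainComplex AddCommGrpCat.{v} ℤ) (h : K.d 0 (-1) = 0) :
    Function.Surjective (zeroClass K h) := by
  rw [← AddCommGrpCat.epi_iff_surjective]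
  have h1 := K.liftCycles_i (𝟙 (K.X 0)) (-1) (by simp) (by rw [h, Limits.comp_zero])
  -- As every element of degree zero is a cycle, the inclusion of cycles has a section and is an
  -- isomorphism.
  have : IsSplitEpi (K.iCycles 0) := IsSplitEpi.mk' ⟨_, h1⟩
  have : IsIso (K.iCycles 0) := isIso_of_mono_of_isSplitEpi _
  have : IsIso (K.liftCycles (𝟙 (K.X 0)) (-1) (by simp) (by rw [h, Limits.comp_zero])) := by
    rw [← IsIso.eq_comp_inv] at h1
    rw [h1]
    infer_instance
  exact epi_comp _ _

theorem zeroClass_eq_zero_iff (K : ChainComplex AddCommGrpCat.{v} ℤ) (h : K.d 0 (-1) = 0)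
    (z : K.X 0) : zeroClass K h z = 0 ↔ ∃ b, K.d 1 0 b = z := by
  have hl := K.liftCycles_i (𝟙 (K.X 0)) (-1) (by simp) (by rw [h, Limits.comp_zero])
  have hz : K.iCycles 0 (K.liftCycles (𝟙 (K.X 0)) (-1) (by simp)
      (by rw [h, Limits.comp_zero]) z) = z := by
    rw [← ConcreteCategory.comp_apply, hl]
    rfl
  constructor
  · intro hc
    have hex := ShortComplex.exact_of_g_is_cokernel
      (ShortComplex.mk (K.toCycles 1 0) (K.homologyπ 0) (K.toCycles_comp_homologyπ 1 0))
      (K.homologyIsCokernel 1 0 (by simp))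
    obtain ⟨b, hb⟩ := (ShortComplex.ab_exact_iff _).1 hex _ hc
    refine ⟨b, ?_⟩
    rw [← K.toCycles_i 1 0, ConcreteCategory.comp_apply, ← hz]
    exact congrArg _ hb
  · rintro ⟨b, rfl⟩
    have : K.d 1 0 ≫ zeroClass K h = 0 := by
      rw [zeroClass, ← Category.assoc, K.comp_liftCycles, ← K.toCycles_comp_homologyπ 1 0]
      congr 1
    rw [← ConcreteCategory.comp_apply, this]
    rfl

theorem zeroClass_naturality {K K' : ChainComplex AddCommGrpCat.{v} ℤ} (f : K ⟶ K')
    (h : K.d 0 (-1) = 0) (h' : K'.d 0 (-1) = 0) :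
    f.f 0 ≫ zeroClass K' h' = zeroClass K h ≫ HomologicalComplex.homologyMap f 0 := by
  rw [zeroClass, zeroClass, Category.assoc, HomologicalComplex.homologyπ_naturality,
    ← Category.assoc, ← Category.assoc]
  congr 1
  rw [← cancel_mono (K'.iCycles 0)]
  simp

/-- Natural quotients with the same kernels are isomorphic. -/
theorem nonempty_iso_of_surjective {C : Type*} [Category* C] {E H H' : C ⥤ AddCommGrpCat.{v}}
    (q : E ⟶ H) (q' : E ⟶ H') (hq : ∀ F, Function.Surjective (q.app F))
    (hq' : ∀ F, Function.Surjective (q'.app F))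
    (h : ∀ F (a : E.obj F), q.app F a = 0 ↔ q'.app F a = 0) : Nonempty (H ≅ H') := by
  have hepi (F : C) : Epi (q.app F) := (AddCommGrpCat.epi_iff_surjective _).2 (hq F)
  have hex (F : C) : ∃ f : H.obj F ⟶ H'.obj F, q.app F ≫ f = q'.app F := by
    refine ⟨AddCommGrpCat.ofHom (AddMonoidHom.liftOfSurjective (q.app F).hom (hq F)
      ⟨(q'.app F).hom, fun a ha => (h F a).1 ha⟩), ?_⟩
    ext a
    exact AddMonoidHom.liftOfRightInverse_comp_apply (q.app F).hom _
      (Function.rightInverse_surjInv (hq F)) ⟨(q'.app F).hom, fun a ha => (h F a).1 ha⟩ a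
  choose f hf using hex
  have hiso (F : C) : IsIso (f F) := by
    rw [ConcreteCategory.isIso_iff_bijective]
    constructor
    · rw [injective_iff_map_eq_zero]
      intro b hb
      obtain ⟨a, rfl⟩ := hq F b
      rw [← ConcreteCategory.comp_apply, hf] at hb
      exact (h F a).2 hb
    · intro b
      obtain ⟨a, rfl⟩ := hq' F b
      exact ⟨q.app F a, by rw [← ConcreteCategory.comp_apply, hf]⟩
  refine ⟨NatIso.ofComponents (fun F => asIso (f F)) fun {F G} g => ?_⟩
  rw [← cancel_epi (q.app F), asIso_hom, asIso_hom, ← Category.assoc, ← q.naturality,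
    Category.assoc, hf, ← Category.assoc, hf, q'.naturality]

end DegreeZero

/-! ### Vertices of the cube complex in degrees at most zero -/

section Comparison

variable {L : Type u} [BooleanAlgebra L] [Finite L]

theorem rank_lt_rank_top {x : L} (hx : x ≠ ⊤) : rank x < rank (⊤ : L) := by
  rw [rank_eq_ncard_atoms, rank_eq_ncard_atoms]
  obtain ⟨a, ha, hax⟩ := exists_isAtom_not_le hx
  refine Set.ncard_lt_ncard ⟨fun b hb => ⟨hb.1, le_top⟩, fun h => hax (h ⟨ha, le_top⟩).2⟩
    (Set.toFinite _)

theorem Vertex.eq_top (x : Vertex L 0) : x.1 = ⊤ := by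
  by_contra h
  have h1 := rank_lt_rank_top h
  have h2 := x.2
  lia

theorem Vertex.isEmpty {i : ℤ} (hi : i < 0) : IsEmpty (Vertex L i) := by
  refine ⟨fun x => ?_⟩
  have h2 := x.2
  rcases eq_or_ne x.1 ⊤ with h | h
  · rw [h] at h2
    lia
  · have h1 := rank_lt_rank_top h
    lia

end Comparison

/-! ### Chains containing `⊤` in degrees at most one -/

section TopChains

variable {X : Type u} [PartialOrder X] [OrderTop X] (F : X ⥤ AddCommGrpCat.{v})

theorem TopChain.isEmpty {i : ℤ} (hi : i < 0) : IsEmpty (TopChain X i) := by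
  refine ⟨fun s => ?_⟩
  have h1 := s.1.2.card_eq
  have h2 := s.1.2.nonempty.card_pos
  lia

theorem TopChain.eq_top (s : TopChain X 0) : s.1.1 = {⊤} := by
  have h1 := s.1.2.card_eq
  obtain ⟨a, ha⟩ := Finset.card_eq_one.1 (show s.1.1.card = 1 by lia)
  have h2 := s.2
  rw [ha, Finset.mem_singleton] at h2
  rw [ha, h2]

theorem toTopChain_map {n : ℤ} {x y : X} (hxy : x ≤ y) {t : Finset X} (hy : ∀ b ∈ t, y ≤ b)
    (l : F.obj x) : toTopChain F n y t (F.map (homOfLE hxy) l) = toTopChain F n x t l := by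
  rw [toTopChain, AddMonoidHom.comp_apply, toChain_map F hxy hy]
  rfl

theorem isNChain_top : IsNChain 0 ({⊤} : Finset X) := ⟨by simp, by simp, by simp⟩

/-- Of the two faces of `{x < ⊤}`, the face `{x}` does not contain `⊤` and is discarded. -/
theorem topD_toTopChain_pair [DecidableEq X] {x : X} (hx : x ≠ ⊤) (l : F.obj x) :
    topD F 1 0 (toTopChain F 1 x {x, ⊤} l) = toTopChain F 0 x {⊤} l := by
  have hx' : x ∉ ({⊤} : Finset X) := by simpa using hx
  have hle : ∀ b ∈ ({x, ⊤} : Finset X), x ≤ b := by simp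
  have hchain : IsChain (· ≤ ·) (({x, ⊤} : Finset X) : Set X) := by
    rw [Finset.coe_pair]
    exact IsChain.pair le_top
  rw [topD_toTopChain F hchain (by simp [Finset.card_pair hx]) hle,
    Finset.sum_insert hx', Finset.sum_singleton, faceSign_of_le hle, one_smul,
    Finset.erase_insert hx', toTopChain_of_notMem F (Finset.notMem_erase ⊤ _), smul_zero, add_zero]

theorem topD_ofTopChain_one (s : TopChain X 1) (l : F.obj s.1.min) :
    s.1.min ≠ ⊤ ∧ topD F 1 0 (ofTopChain F s l) = toTopChain F 0 s.1.min {⊤} l := by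
  classical
  have hcard := s.1.2.card_eq
  have hne : s.1.min ≠ ⊤ := by
    intro h
    have : s.1.1.card ≤ 1 := Finset.card_le_one.2 fun a ha b hb => by
      have h1 := s.1.min_isLeast.2 ha
      have h2 := s.1.min_isLeast.2 hb
      rw [h] at h1 h2
      exact (top_le_iff.1 h1).trans (top_le_iff.1 h2).symm
    lia
  refine ⟨hne, ?_⟩
  have hs : s.1.1 = {s.1.min, ⊤} := by
    refine (Finset.eq_of_subset_of_card_le ?_ ?_).symm
    · intro a ha
      rcases Finset.mem_insert.1 ha with rfl | ha
      · exact s.1.min_isLeast.1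
      · exact Finset.mem_singleton.1 ha ▸ s.2
    · rw [Finset.card_pair hne]
      lia
  rw [← topD_toTopChain_pair F hne, ← hs, toTopChain_self]

end TopChains

/-! ### Comparison of the two complexes -/

section Comparison

variable {L : Type u} [BooleanAlgebra L] (F : L ⥤ AddCommGrpCat.{v})

/-- The greatest element as the vertex of degree zero. -/
def Vertex.top : Vertex L 0 := ⟨⊤, (sub_zero _).symm⟩

theorem Vertex.le_top (x : L) : x ≤ (Vertex.top : Vertex L 0).1 := _root_.le_top

/-- The identification of the groups in degree zero: both are `F ⊤`. -/
def compareZero : CubeGroup F 0 →+ TopChainGroup F 0 := by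
  classical
  exact DirectSum.toAddMonoid fun x : Vertex L 0 => toTopChain F 0 x.1 {⊤}

theorem compareZero_of (x : Vertex L 0) (l : F.obj x.1) :
    compareZero F (ofVertex F x l) = toTopChain F 0 x.1 {⊤} l := by
  classical
  exact DirectSum.toAddMonoid_of _ _ _

/-- The inverse of `compareZero`. -/
def compareZeroInv : TopChainGroup F 0 →+ CubeGroup F 0 := by
  classical
  exact DirectSum.toAddMonoid fun s : TopChain L 0 =>
    (ofVertex F Vertex.top).comp (F.map (homOfLE (Vertex.le_top s.1.min))).hom

theorem compareZeroInv_of (s : TopChain L 0) (l : F.obj s.1.min) :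
    compareZeroInv F (ofTopChain F s l) =
      ofVertex F Vertex.top (F.map (homOfLE (Vertex.le_top s.1.min)) l) := by
  classical
  exact DirectSum.toAddMonoid_of _ _ _

theorem compareZero_surjective : Function.Surjective (compareZero F) := by
  suffices h : (compareZero F).comp (compareZeroInv F) = AddMonoidHom.id _ from
    fun c => ⟨_, DFunLike.congr_fun h c⟩
  refine topChainGroup_hom_ext fun s l => ?_
  rw [AddMonoidHom.comp_apply, compareZeroInv_of, compareZero_of]
  refine (toTopChain_map F (Vertex.le_top s.1.min) (by simp) l).trans ?_
  rw [← s.eq_top, toTopChain_self]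
  rfl

theorem compareZero_naturality {F G : L ⥤ AddCommGrpCat.{v}} (φ : F ⟶ G) :
    (compareZero G).comp (cubeMap φ 0) = (topMap φ 0).comp (compareZero F) := by
  refine cubeGroup_hom_ext F fun x l => ?_
  rw [AddMonoidHom.comp_apply, AddMonoidHom.comp_apply, cubeMap_of, compareZero_of,
    compareZero_of, topMap_toTopChain]

variable [Finite L]

theorem ofVertex_eq_top (x : Vertex L 0) (l : F.obj x.1) :
    ofVertex F x l = ofVertex F Vertex.top (F.map (homOfLE (Vertex.le_top x.1)) l) := by
  obtain ⟨x, hx⟩ := x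
  obtain rfl : x = ⊤ := Vertex.eq_top ⟨x, hx⟩
  change _ = ofVertex F Vertex.top (F.map (𝟙 ⊤) l)
  rw [F.map_id]
  rfl

theorem compareZero_injective : Function.Injective (compareZero F) := by
  suffices h : (compareZeroInv F).comp (compareZero F) = AddMonoidHom.id _ from
    Function.LeftInverse.injective (g := compareZeroInv F) fun c => DFunLike.congr_fun h c
  refine cubeGroup_hom_ext F fun x l => ?_
  rw [AddMonoidHom.comp_apply, compareZero_of, toTopChain_apply F isNChain_top (by simp) (by simp),
    compareZeroInv_of, AddMonoidHom.id_apply, ofVertex_eq_top F x l, ← ConcreteCategory.comp_apply,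
    ← F.map_comp]
  rfl

variable {n : ℕ} (e : Fin n ≃ {a : L // IsAtom a})

/-- Each cover relation `x ⋖ ⊤` is in particular a chain `{x < ⊤}`, which has the same boundary up
to sign. -/
theorem exists_topD_eq_compareZero (b : CubeGroup F 1) :
    ∃ c, topD F 1 0 c = compareZero F (cubeD F e 1 0 b) := by
  classical
  let _ := Fintype.ofFinite (Vertex L 0)
  let q := QuotientAddGroup.mk' (topD F 1 0).range
  have key : q.comp ((compareZero F).comp (cubeD F e 1 0)) = 0 := by
    refine cubeGroup_hom_ext F fun x l => ?_
    refine (QuotientAddGroup.eq_zero_iff _).2 ?_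
    rw [AddMonoidHom.comp_apply, cubeD_of, map_sum]
    refine AddSubgroup.sum_mem _ fun y _ => ?_
    split_ifs with h
    · rw [map_zsmul, compareZero_of, toTopChain_map F h.le (by simp),
        ← topD_toTopChain_pair F (h.lt.trans_le le_top).ne]
      exact AddSubgroup.zsmul_mem _ (AddMonoidHom.mem_range.2 ⟨_, rfl⟩) _
    · rw [map_zero]
      exact AddSubgroup.zero_mem _
  exact (QuotientAddGroup.eq_zero_iff _).1 (DFunLike.congr_fun key b)

theorem compareZero_cubeD_of_covBy {x : Vertex L 1} (hx : x.1 ⋖ ⊤) (l : F.obj x.1) :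
    compareZero F (cubeD F e 1 0 (ofVertex F x l)) =
      coverSign e hx • toTopChain F 0 x.1 {⊤} l := by
  classical
  let _ := Fintype.ofFinite (Vertex L 0)
  have htop : x.1 ⋖ (Vertex.top : Vertex L 0).1 := hx
  rw [cubeD_of, Finset.sum_eq_single Vertex.top]
  · rw [dif_pos htop, map_zsmul, compareZero_of]
    exact congrArg _ (toTopChain_map F hx.le (by simp) l)
  · exact fun y _ hy => absurd (Subtype.ext y.eq_top) hy
  · exact fun h => absurd (Finset.mem_univ _) h

/-- The map from `F x` to `F ⊤` factors through a coatom above `x`, so the cube boundaries already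
include the boundaries of all chains `{x < ⊤}`. -/
theorem exists_compareZero_eq_topD (c : TopChainGroup F 1) :
    ∃ b, compareZero F (cubeD F e 1 0 b) = topD F 1 0 c := by
  let q := QuotientAddGroup.mk' ((compareZero F).comp (cubeD F e 1 0)).range
  have key : q.comp (topD F 1 0) = 0 := by
    refine topChainGroup_hom_ext fun s l => ?_
    refine (QuotientAddGroup.eq_zero_iff _).2 ?_
    obtain ⟨hne, hs⟩ := topD_ofTopChain_one F s l
    obtain ⟨y, hy, hcov⟩ := exists_le_covBy_of_lt (lt_top_iff_ne_top.2 hne)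
    have hr : (rank y : ℤ) = rank (⊤ : L) - 1 := by
      have := rank_covBy hcov
      lia
    -- The factor `coverSign e hcov` compensates for the sign in the cube differential, since its
    -- square is `1`.
    refine ⟨coverSign e hcov • ofVertex F ⟨y, hr⟩ (F.map (homOfLE hy) l), ?_⟩
    rw [map_zsmul, AddMonoidHom.comp_apply, compareZero_cubeD_of_covBy F e hcov, ← mul_smul,
      ← incidence_of_covBy, incidence_mul_self e hcov, one_smul, hs]
    exact toTopChain_map F hy (by simp) l
  exact (QuotientAddGroup.eq_zero_iff _).1 (DFunLike.congr_fun key c)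

theorem cubeComplex_d_zero : (cubeComplex F e).d 0 (-1) = 0 := by
  have := Vertex.isEmpty (L := L) (i := -1) (by simp)
  ext1
  exact AddMonoidHom.ext fun c => Subsingleton.elim (α := CubeGroup F (-1)) _ _

theorem topComplex_d_zero {X : Type u} [PartialOrder X] [OrderTop X] (F : X ⥤ AddCommGrpCat.{v}) :
    (topComplex F).d 0 (-1) = 0 := by
  have := TopChain.isEmpty (X := X) (i := -1) (by simp)
  ext1
  exact AddMonoidHom.ext fun c => Subsingleton.elim (α := TopChainGroup F (-1)) _ _

/-- The zeroth homology functors of the two complexes are isomorphic. -/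
theorem nonempty_homology_zero_iso :
    Nonempty (cubeFunctor.{u, v} e ⋙
        HomologicalComplex.homologyFunctor AddCommGrpCat.{max u v} (ComplexShape.down ℤ) 0 ≅
      topFunctor.{u, v} L ⋙
        HomologicalComplex.homologyFunctor AddCommGrpCat.{max u v} (ComplexShape.down ℤ) 0) := by
  let E : (L ⥤ AddCommGrpCat.{v}) ⥤ AddCommGrpCat.{max u v} :=
    cubeFunctor e ⋙ HomologicalComplex.eval _ _ 0
  refine nonempty_iso_of_surjective (E := E)
    { app := fun F => zeroClass (cubeComplex F e) (cubeComplex_d_zero F e)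
      naturality := fun F G φ => zeroClass_naturality ((cubeFunctor e).map φ) _ _ }
    { app := fun F => AddCommGrpCat.ofHom (compareZero F) ≫
        zeroClass (topComplex F) (topComplex_d_zero F)
      naturality := fun F G φ => ?_ } 
    (fun F => zeroClass_surjective (cubeComplex F e) (cubeComplex_d_zero F e)) (fun F => ?_)
    (fun F a => ?_)
  · have h : AddCommGrpCat.ofHom (cubeMap φ 0) ≫ AddCommGrpCat.ofHom (compareZero G) =
        AddCommGrpCat.ofHom (compareZero F) ≫ AddCommGrpCat.ofHom (topMap φ 0) := by
      rw [← AddCommGrpCat.ofHom_comp, compareZero_naturality]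
      rfl
    have h' := zeroClass_naturality ((topFunctor L).map φ) (topComplex_d_zero F)
      (topComplex_d_zero G)
    exact ((CommSq.mk h.symm).horiz_comp (CommSq.mk h'.symm)).w.symm
  · exact (zeroClass_surjective (topComplex F) (topComplex_d_zero F)).comp (compareZero_surjective F)
  · refine (zeroClass_eq_zero_iff (cubeComplex F e) (cubeComplex_d_zero F e) a).trans
      (Iff.trans ?_ (zeroClass_eq_zero_iff (topComplex F) (topComplex_d_zero F) (compareZero F a)).symm)
    constructor
    · rintro ⟨b, rfl⟩
      exact exists_topD_eq_compareZero F e b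
    · rintro ⟨c, hc⟩
      obtain ⟨b, hb⟩ := exists_compareZero_eq_topD F e c
      exact ⟨b, compareZero_injective F (hb.trans hc)⟩

theorem isZero_homology_of_subsingleton (K : ChainComplex AddCommGrpCat.{v} ℤ) (i : ℤ)
    [Subsingleton (K.X i)] : Limits.IsZero (K.homology i) :=
  isZero_homology_of_forall_cycle K i fun _ _ => ⟨0, Subsingleton.elim _ _⟩

/-- Negative degrees are treated apart because neither complex has any summands there; the dimension
shift runs over the natural numbers. -/
theorem nonempty_homology_iso (i : ℤ) :
    Nonempty ((cubeComplex F e).homology i ≅ (topComplex F).homology i) := by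
  rcases lt_or_ge i 0 with hi | hi
  · have := Vertex.isEmpty (L := L) hi
    have := TopChain.isEmpty (X := L) hi
    have h1 : Subsingleton ((cubeComplex F e).X i) := inferInstanceAs (Subsingleton (CubeGroup F i))
    have h2 : Subsingleton ((topComplex F).X i) :=
      inferInstanceAs (Subsingleton (TopChainGroup F i))
    exact ⟨(isZero_homology_of_subsingleton _ i).iso (isZero_homology_of_subsingleton _ i)⟩
  · obtain ⟨i, rfl⟩ := Int.eq_ofNat_of_zero_le hi
    obtain ⟨φ⟩ := nonempty_homology_zero_iso.{u, v} e
    refine nonempty_homology_iso_of_effaceable (cubeFunctor e) (topFunctor L)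
      (shortExact_cubeFunctor e) shortExact_topFunctor (fun F => ?_) φ i F
    obtain ⟨P, p, hp, h⟩ := exists_epi_of_induced F
    exact ⟨P, p, hp, fun i hi =>
      ⟨h (cubeFunctor e ⋙ HomologicalComplex.homologyFunctor _ _ i) fun x =>
          isZero_cubeComplex_induced_homology e x _ hi,
        h (topFunctor L ⋙ HomologicalComplex.homologyFunctor _ _ i) fun x =>
          isZero_topComplex_induced_homology x _ hi⟩⟩

end Comparison

end PosetHomology
end

theorem mainTheorem4 {L : Type u} [BooleanAlgebra L] [Finite L] (F : L ⥤ AddCommGrpCat.{v})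
    {r : ℕ} (e : Fin r ≃ {a : L // IsAtom a}) (n : ℤ) :
    Nonempty ((PosetHomology.cubeComplex F e).homology n ≅
      PosetHomology.relativeHomology F ({⊤}ᶜ : Set L) n) := by
  obtain ⟨i⟩ := PosetHomology.nonempty_homology_iso F e n
  exact ⟨i ≪≫ (HomologicalComplex.homologyMapIso (PosetHomology.relativeComplexIso F) n).symm⟩
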